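/- Fix $\Delta \in \mathbb{N}$ and let $\mathcal{G}$ be the family of all finite trees $G=(V,E,\sigma)$ of maximum degree at most $\Delta$ with an arbitrary input labeling $\sigma\colon V\to\Sigma$; write $n=|V|$. A verifier $\psi$ maps each triple $(G,\lambda,v)$ with $G \in \mathcal{G}$, $\lambda\colon V\to\Gamma$, $v\in V$ to "happy" or "unhappy"; it accepts $(G,\lambda)$ if it is happy at every node. It has verification radius $r$ if its value at $(G,\lambda,v)$ depends only on the isomorphism class of the radius-$r$ neighborhood of $v$ with center $v$ and with its input and output labels. An LCL problem $\Pi$ on $\mathcal{G}$ is given by finite sets $\Sigma,\Gamma$ of input and output labels and, for each $G\in\mathcal{G}$, a set of feasible labelings $\lambda\colon V\to\Gamma$, such that for some $r \in \mathbb{N}$ there is a radius-$r$ verifier for $\Pi$, that is, one that accepts exactly the feasible labelings. For a radius-$r$ verifier $\psi$ and a partial labeling $\lambda\colon V\to\Gamma\cup\{\bot\}$, let $\psi^*$ be happy at $v$ if some node within distance $r$ of $v$ is labeled $\bot$; otherwise $\psi^*(G,\lambda,v)=\psi(G,\lambda',v)$ for any $\lambda'\colon V\to\Gamma$ that agrees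 with $\lambda$ within distance $r$ of $v$. If $\psi^*$ accepts $\lambda$, a $t$-mend of $\lambda$ at $v$ is a $\mu\colon V\to\Gamma\cup\{\bot\}$ accepted by $\psi^*$ such that $\mu(v)\neq\bot$, $\mu(u)=\bot$ implies $\lambda(u)=\bot$, and $\mu(u)\neq\lambda(u)$ implies that $u$ is within distance $t$ of $v$. For $T\colon\mathbb{N}\to\mathbb{N}$, the radius-$r$ verifier $\psi$ is $T$-mendable if for every $G\in\mathcal{G}$, every $\lambda$ accepted by $\psi^*$ and every $v\in V$ there is a $T(n)$-mend of $\lambda$ at $v$. The problem $\Pi$ is $T$-mendable if for some $r$ there is a $T$-mendable radius-$r$ verifier for $\Pi$. The mending radius of $\Pi$ is $T$ if $\Pi$ is $T$-mendable but not $T'$-mendable for any $T'\neq T$ with $T'(n)\le T(n)$ for all $n$. Theorem. Let $\Pi$ be an LCL problem on $\mathcal{G}$. If $\Pi$ is $T$-mendable for some $T(n)=o(n)$, then $\Pi$ is $T'$-mendable for some $T'(n)=O(\log n)$. Moreover, there is no function $T$ with $T(n)=\omega(\log n)$ and $T(n)=o(n)$ such that the mending radius of $\Pi$ is $T$. -/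

import Mathlib

open Filter Asymptotics

namespace Mending

universe u v

/-- A finite simple graph `G = (V, E, σ)` together with an input labeling `σ : V → S`. -/
structure InputGraph (S : Type u) where
  /-- the vertex set -/
  V : Type
  /-- the vertex set is finite -/
  finite_V : Finite V
  /-- the edges -/
  graph : SimpleGraph V
  /-- the input labeling -/
  input : V → S

attribute [instance] InputGraph.finite_V

/-- The set of nodes within distance `r` of `v` (unreachable nodes are at distance `⊤`). -/
def InputGraph.ball {S : Type u} (G : InputGraph S) (v : G.V) (r : ℕ) : Set G.V :=
  {w | G.graph.edist v w ≤ (r : ℕ∞)}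

/-- The radius-`r` neighborhoods of `v` in `(G, out)` and of `v'` in `(G', out')`, together with
the centers and the input and output labels, are isomorphic. -/
def SameView {S : Type u} {Γ : Type v} (r : ℕ)
    (G : InputGraph S) (out : G.V → Γ) (x : G.V)
    (G' : InputGraph S) (out' : G'.V → Γ) (x' : G'.V) : Prop :=
  ∃ e : G.graph.induce (G.ball x r) ≃g G'.graph.induce (G'.ball x' r),
    (∀ w : G.ball x r, (w : G.V) = x → (e w : G'.V) = x') ∧
    (∀ w : G.ball x r, G'.input (e w : G'.V) = G.input (w : G.V)) ∧
    (∀ w : G.ball x r, out' (e w : G'.V) = out (w : G.V))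

/-- A verifier: `ψ G out x` says that `ψ` is happy at the node `x` of `G` with output `out`. -/
def Verifier (S : Type u) (Γ : Type v) : Type (max 1 u v) :=
  (G : InputGraph S) → (G.V → Γ) → G.V → Prop

namespace Verifier

variable {S : Type u} {Γ : Type v}

/-- `ψ` accepts `(G, out)` if it is happy at every node. -/
def Accepts (ψ : Verifier S Γ) (G : InputGraph S) (out : G.V → Γ) : Prop :=
  ∀ x, ψ G out x

/-- `ψ` is a local verifier with verification radius `r` on the graph family `𝒢`. -/
def IsLocal (ψ : Verifier S Γ) (𝒢 : Set (InputGraph S)) (r : ℕ) : Prop :=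
  ∀ G ∈ 𝒢, ∀ G' ∈ 𝒢, ∀ (out : G.V → Γ) (out' : G'.V → Γ) (x : G.V) (x' : G'.V),
    SameView r G out x G' out' x' → (ψ G out x ↔ ψ G' out' x')

/-- The relaxation of a radius-`r` verifier to partial labelings (`none` is the empty label):
happy if there is an empty label within distance `r`; otherwise the value of `ψ` on a complete
labeling that agrees with the given one in the radius-`r` neighborhood. -/
def star (ψ : Verifier S Γ) (r : ℕ) : Verifier S (Option Γ) := fun G out x =>
  (∃ w ∈ G.ball x r, out w = none) ∨
    ∃ out' : G.V → Γ, (∀ w ∈ G.ball x r, out w = some (out' w)) ∧ ψ G out' x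

/-- `new` is a `t`-mend of the partial labeling `old` of `G` at the node `x`, with respect to the
radius-`r` verifier `ψ`. -/
structure IsMend (ψ : Verifier S Γ) (r : ℕ) (G : InputGraph S) (t : ℕ) (x : G.V)
    (old new : G.V → Option Γ) : Prop where
  accepts : (ψ.star r).Accepts G new
  filled : new x ≠ none
  no_new_hole : ∀ w, new w = none → old w = none
  near : ∀ w, new w ≠ old w → w ∈ G.ball x t

/-- The radius-`r` verifier `ψ` is `T`-mendable on the graph family `𝒢`. -/
def IsMendable (ψ : Verifier S Γ) (r : ℕ) (𝒢 : Set (InputGraph S)) (T : ℕ → ℕ) : Prop :=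
  ∀ G ∈ 𝒢, ∀ old : G.V → Option Γ, (ψ.star r).Accepts G old →
    ∀ x : G.V, ∃ new : G.V → Option Γ, ψ.IsMend r G (T (Nat.card G.V)) x old new

end Verifier

/-- A graph problem: the set of feasible solutions of each input-labeled graph. -/
def Problem (S : Type u) (Γ : Type v) : Type (max 1 u v) :=
  (G : InputGraph S) → Set (G.V → Γ)

namespace Problem

variable {S : Type u} {Γ : Type v}

/-- `ψ` is a radius-`r` verifier for the problem `P` on the graph family `𝒢`. -/
def IsVerifiedBy (P : Problem S Γ) (𝒢 : Set (InputGraph S)) (ψ : Verifier S Γ) (r : ℕ) : Prop :=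
  ψ.IsLocal 𝒢 r ∧ ∀ G ∈ 𝒢, ∀ out : G.V → Γ, ψ.Accepts G out ↔ out ∈ P G

/-- `P` is an LCL problem on the graph family `𝒢`: it is locally verifiable, the sets of input and
output labels are finite, and `𝒢` has bounded degree. -/
structure IsLCL (P : Problem S Γ) (𝒢 : Set (InputGraph S)) : Prop where
  finite_input : Finite S
  finite_output : Finite Γ
  bounded_degree : ∃ Δ : ℕ, ∀ G ∈ 𝒢, ∀ x : G.V, (G.graph.neighborSet x).ncard ≤ Δ
  verifiable : ∃ (r : ℕ) (ψ : Verifier S Γ), P.IsVerifiedBy 𝒢 ψ r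

/-- `P` is `T`-mendable on `𝒢`: some local verifier for `P` is `T`-mendable. -/
def IsMendable (P : Problem S Γ) (𝒢 : Set (InputGraph S)) (T : ℕ → ℕ) : Prop :=
  ∃ (r : ℕ) (ψ : Verifier S Γ), P.IsVerifiedBy 𝒢 ψ r ∧ ψ.IsMendable r 𝒢 T

/-- The mending radius of `P` on `𝒢` is `T`. -/
def HasMendingRadius (P : Problem S Γ) (𝒢 : Set (InputGraph S)) (T : ℕ → ℕ) : Prop :=
  P.IsMendable 𝒢 T ∧
    ∀ T' : ℕ → ℕ, T' ≠ T → (∀ n, T' n ≤ T n) → ¬ P.IsMendable 𝒢 T'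

end Problem

/-- The family of all finite trees of maximum degree at most `Δ`, with all input labelings. -/
def boundedDegreeTrees (S : Type u) (Δ : ℕ) : Set (InputGraph S) :=
  {G | G.graph.IsTree ∧ ∀ x : G.V, (G.graph.neighborSet x).ncard ≤ Δ}

end Mending

/-! Root the tree at the node `v` to be mended. A node `u` is critical for depth `t` if some
labeling that is good below `u` cannot keep its labels near `u` while being reset to `old` below
depth `t`. If `v` has a mend but no `t`-mend, then `v` is critical; and a critical node of depth at
most `t` has a critical child, because extensions below the children glue together
(`extends_of_isChild`).

If critical descents meet a second critical child within every `L` steps, the critical nodes branch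
exponentially, so `t = O(L log n)` suffices (`exists_isMend_of_not_criticalPath`). Otherwise there
is a critical path of length `L` with no critical child beside it. For a suitable `L` depending only
on the alphabets, `Δ` and `r`, pigeonhole gives two nodes on it whose neighborhoods agree in
structure, labels and the set of extendable boundary labelings
(`CriticalPath.exists_labeledSegment`).

The segment between them can then be repeated. Label the upper half of the pumped tree by `new`,
which is good but not extendable, the lower half by `old`, and put a hole in between. The segment is
fixed while the number of copies grows, so a sublinear mend of the hole leaves the labels near both
ends alone. Extendability holds at the bottom, where the labels are `old`, and climbs copy by copy
through the mended labels, since only the path carries critical nodes. It thus reaches `new` at the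
top, a contradiction (`LabeledSegment.false_of_isMend`).

Hence the same verifier that has sublinear mends also has logarithmic ones, and minimality of the
mending radius is contradicted by the pointwise minimum of the two bounds. -/

namespace SimpleGraph

variable {V W : Type*} {G : SimpleGraph V}

/-! ### Distances and descendant sets in rooted trees. -/

lemma Connected.exists_adj_dist_add_one_left (hG : G.Connected) {u x : V} (h : u ≠ x) :
    ∃ w, G.Adj u w ∧ G.dist w x + 1 = G.dist u x := by
  obtain ⟨p, hp⟩ := hG.exists_walk_length_eq_dist u x
  cases p with
  | nil => exact absurd rfl h
  | @cons _ w _ huw q =>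
    refine ⟨w, huw, ?_⟩
    have h1 := G.dist_le q
    have h2 := hG.dist_triangle (u := u) (v := w) (w := x)
    have h3 := dist_eq_one_iff_adj.2 huw
    simp only [Walk.length_cons] at hp
    omega

lemma Connected.exists_adj_dist_add_one (hG : G.Connected) {u x : V} (h : x ≠ u) :
    ∃ w, G.Adj x w ∧ G.dist u w + 1 = G.dist u x := by
  obtain ⟨w, hw, h'⟩ := hG.exists_adj_dist_add_one_left h
  exact ⟨w, hw, by rw [dist_comm, h', dist_comm]⟩

/-- Uniqueness of parents: geodesics to `x` through `y` and through `z` are paths with the same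
ends, hence equal. -/
lemma IsTree.eq_of_adj_of_dist_add_one (hG : G.IsTree) {u x y z : V} (hy : G.Adj x y)
    (hz : G.Adj x z) (hdy : G.dist u y + 1 = G.dist u x) (hdz : G.dist u z + 1 = G.dist u x) :
    y = z := by
  obtain ⟨p, hp⟩ := hG.connected.exists_walk_length_eq_dist u y
  have hq : (p.concat hy.symm).IsPath :=
    Walk.isPath_of_length_eq_dist _ (by rw [Walk.length_concat, hp, hdy])
  have h2 : z ∈ (p.concat hy.symm).support := by
    by_contra hcon
    obtain ⟨q, hq'⟩ := hG.connected.exists_walk_length_eq_dist u z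
    have hq2 : (q.concat hz.symm).IsPath :=
      Walk.isPath_of_length_eq_dist _ (by rw [Walk.length_concat, hq', hdz])
    have h3 : p.concat hy.symm = q.concat hz.symm :=
      congrArg Subtype.val ((hG.isAcyclic.subsingleton_path u x).elim ⟨_, hq⟩ ⟨_, hq2⟩)
    rw [h3] at hcon
    simp [Walk.support_concat] at hcon
  have := hG.isAcyclic.eq_penultimate_of_adj_end hq hz h2
  simpa using this.symm

/-- A walk out of `D` has to visit its only exit `w`. -/
lemma Connected.dist_eq_add_of_exits (hG : G.Connected) {D : Set V} {w : V}
    (hD : ∀ x ∈ D, ∀ z ∉ D, G.Adj x z → x = w) {x z : V} (hx : x ∈ D) (hz : z ∉ D) :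
    G.dist x z = G.dist x w + G.dist w z := by
  refine le_antisymm hG.dist_triangle ?_
  obtain ⟨p, hp⟩ := hG.exists_walk_length_eq_dist x z
  rw [← hp]
  clear hp
  induction p with
  | nil => exact absurd hx hz
  | @cons x y z hxy q ih =>
    rw [Walk.length_cons]
    by_cases hy : y ∈ D
    · have h1 := ih hy hz
      have h2 := hG.dist_triangle (u := x) (v := y) (w := w)
      have h3 := dist_eq_one_iff_adj.2 hxy
      omega
    · obtain rfl := hD x hx y hy hxy
      have h2 := G.dist_le (Walk.cons hxy q)
      simpa using h2

/-- The set of descendants of `u` in the tree `G` rooted at `v`. -/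
def desc (G : SimpleGraph V) (v u : V) : Set V :=
  {x | G.dist v x = G.dist v u + G.dist u x}

/-- `w` is a child of `u` in the tree `G` rooted at `v`. -/
def IsChild (G : SimpleGraph V) (v u w : V) : Prop :=
  G.Adj u w ∧ G.dist v w = G.dist v u + 1

lemma mem_desc_self (v u : V) : u ∈ G.desc v u := by simp [desc]

lemma desc_root (v : V) : G.desc v v = Set.univ := by ext; simp [desc]

lemma IsTree.mem_desc_of_adj (hG : G.IsTree) {v u x z : V} (hx : x ∈ G.desc v u)
    (hxz : G.Adj x z) (h : x ≠ u ∨ G.dist v z = G.dist v x + 1) : z ∈ G.desc v u := by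
  have ht := hG.connected.dist_triangle (u := v) (v := u) (w := z)
  have ht2 := hG.connected.dist_triangle (u := u) (v := x) (w := z)
  have h1 := dist_eq_one_iff_adj.2 hxz
  have hx' : G.dist v x = G.dist v u + G.dist u x := hx
  change G.dist v z = G.dist v u + G.dist u z
  rcases hG.dist_eq_dist_add_one_of_adj v hxz with h2 | h2
  · have hxu : x ≠ u := by rcases h with h | h <;> [exact h; omega]
    obtain ⟨w, hw, hdw⟩ := hG.connected.exists_adj_dist_add_one hxu
    have ht3 := hG.connected.dist_triangle (u := v) (v := u) (w := w)
    have ht4 := hG.connected.dist_triangle (u := v) (v := w) (w := x)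
    rw [dist_eq_one_iff_adj.2 hw.symm] at ht4
    have : w = z := hG.eq_of_adj_of_dist_add_one (u := v) hw hxz (by omega) (by omega)
    subst this
    omega
  · omega

lemma IsTree.desc_exit (hG : G.IsTree) {v u x z : V} (hx : x ∈ G.desc v u) (hz : z ∉ G.desc v u)
    (hxz : G.Adj x z) : x = u ∧ G.IsChild v z u := by
  by_cases h : x = u ∨ G.dist v z = G.dist v x + 1
  · have h0 : G.dist v z ≠ G.dist v x + 1 := fun h' => hz (hG.mem_desc_of_adj hx hxz (Or.inr h'))
    obtain rfl := h.resolve_right h0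
    refine ⟨rfl, hxz.symm, ?_⟩
    exact (hG.dist_eq_dist_add_one_of_adj v hxz).resolve_right h0
  · push Not at h
    exact absurd (hG.mem_desc_of_adj hx hxz (Or.inl h.1)) hz

lemma IsTree.dist_of_mem_desc (hG : G.IsTree) {v u x z : V} (hx : x ∈ G.desc v u)
    (hz : z ∉ G.desc v u) : G.dist x z = G.dist x u + G.dist u z :=
  hG.connected.dist_eq_add_of_exits (fun _ hx _ hz h => (hG.desc_exit hx hz h).1) hx hz

lemma IsTree.isChild_unique (hG : G.IsTree) {v u u' w : V} (h : G.IsChild v u w)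
    (h' : G.IsChild v u' w) : u = u' :=
  hG.eq_of_adj_of_dist_add_one h.1.symm h'.1.symm h.2.symm h'.2.symm

lemma IsTree.isChild_or_isChild (hG : G.IsTree) (v : V) {u w : V} (h : G.Adj u w) :
    G.IsChild v u w ∨ G.IsChild v w u :=
  (hG.dist_eq_dist_add_one_of_adj v h).symm.imp (fun h' => ⟨h, h'⟩) (fun h' => ⟨h.symm, h'⟩)

lemma IsChild.mem_desc {v u w : V} (h : G.IsChild v u w) : w ∈ G.desc v u := by
  change _ = _
  rw [h.2, dist_eq_one_iff_adj.2 h.1]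

lemma IsTree.desc_subset (hG : G.IsTree) {v u w : V} (h : w ∈ G.desc v u) :
    G.desc v w ⊆ G.desc v u := by
  intro x hx
  have ht := hG.connected.dist_triangle (u := v) (v := u) (w := x)
  have ht2 := hG.connected.dist_triangle (u := u) (v := w) (w := x)
  simp only [desc, Set.mem_ofPred_eq] at *
  omega

lemma IsTree.not_mem_desc_of_dist_le (hG : G.IsTree) {v u w : V} (h : G.dist v u ≤ G.dist v w)
    (hne : u ≠ w) : u ∉ G.desc v w := by
  intro h'
  have := hG.connected.pos_dist_of_ne hne.symm
  simp only [desc, Set.mem_ofPred_eq] at h'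
  omega

lemma IsChild.not_mem_desc (hG : G.IsTree) {v u w : V} (h : G.IsChild v u w) :
    u ∉ G.desc v w :=
  hG.not_mem_desc_of_dist_le (by rw [h.2]; omega) h.1.ne

lemma IsTree.exists_isChild_of_mem_desc (hG : G.IsTree) {v u x : V} (hx : x ∈ G.desc v u)
    (hne : x ≠ u) : ∃ w, G.IsChild v u w ∧ x ∈ G.desc v w := by
  obtain ⟨w, hw, hd⟩ := hG.connected.exists_adj_dist_add_one_left hne.symm
  have ht := hG.connected.dist_triangle (u := v) (v := w) (w := x)
  have ht2 := hG.connected.dist_triangle (u := v) (v := u) (w := w)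
  rw [dist_eq_one_iff_adj.2 hw] at ht2
  simp only [desc, Set.mem_ofPred_eq] at *
  exact ⟨w, ⟨hw, by omega⟩, by omega⟩

lemma IsTree.desc_disjoint (hG : G.IsTree) {v w w' : V} (h : G.dist v w = G.dist v w')
    (hne : w ≠ w') : Disjoint (G.desc v w) (G.desc v w') := by
  rw [Set.disjoint_left]
  intro x hx hx'
  have h1 := hG.dist_of_mem_desc hx (hG.not_mem_desc_of_dist_le h.ge hne.symm)
  have h2 := hG.dist_of_mem_desc hx' (hG.not_mem_desc_of_dist_le h.le hne)
  have := hG.connected.pos_dist_of_ne hne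
  have h3 : G.dist w w' = G.dist w' w := dist_comm
  omega

lemma Connected.ncard_dist_le [Finite V] (hG : G.Connected) {Δ : ℕ}
    (hΔ : ∀ x, (G.neighborSet x).ncard ≤ Δ) (u : V) (r : ℕ) :
    {x | G.dist u x ≤ r}.ncard ≤ (Δ + 1) ^ r := by
  induction r with
  | zero =>
    have : {x | G.dist u x ≤ 0} = {u} := by
      ext x
      simp [hG.dist_eq_zero_iff, eq_comm]
    rw [this, Set.ncard_singleton, pow_zero]
  | succ r ih =>
    have hsub : {x | G.dist u x ≤ r + 1} ⊆
        ⋃ y ∈ (Set.toFinite {x | G.dist u x ≤ r}).toFinset, insert y (G.neighborSet y) := by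
      intro x hx
      simp only [Set.Finite.mem_toFinset, Set.mem_iUnion, Set.mem_ofPred_eq, Set.mem_insert_iff,
        mem_neighborSet, exists_prop] at hx ⊢
      by_cases h : x = u
      · exact ⟨u, by simp, Or.inl h⟩
      · obtain ⟨w, hw, hd⟩ := hG.exists_adj_dist_add_one h
        exact ⟨w, by omega, Or.inr hw.symm⟩
    refine (Set.ncard_le_ncard hsub (Set.toFinite _)).trans ?_
    refine (Finset.set_ncard_biUnion_le _ _).trans ?_
    refine (Finset.sum_le_card_nsmul _ _ (Δ + 1) fun y _ => ?_).trans ?_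
    · exact (Set.ncard_insert_le _ _).trans (Nat.succ_le_succ (hΔ y))
    · rw [← Set.ncard_eq_toFinset_card _ (Set.toFinite _), smul_eq_mul, pow_succ]
      exact Nat.mul_le_mul_right _ ih

/-- A graph whose non-root vertices have exactly one neighbor of lower rank is a tree. -/
lemma isTree_of_rank [Finite V] (root : V) (rank : V → ℕ) (par : V → V)
    (hpar : ∀ x, x ≠ root → G.Adj x (par x) ∧ rank (par x) < rank x)
    (huniq : ∀ x y, G.Adj x y → (x ≠ root ∧ y = par x) ∨ (y ≠ root ∧ x = par y)) : G.IsTree := by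
  classical
  have hreach : ∀ n x, rank x = n → G.Reachable x root := by
    intro n
    induction n using Nat.strong_induction_on with
    | _ n ih =>
      intro x hx
      by_cases h : x = root
      · rw [h]
      · exact (hpar x h).1.reachable.trans (ih _ (hx ▸ (hpar x h).2) _ rfl)
  have hconn : G.Connected :=
    { preconnected := fun x y => (hreach _ x rfl).trans (hreach _ y rfl).symm
      nonempty := ⟨root⟩ }
  rw [isTree_iff_connected_and_card]
  refine ⟨hconn, ?_⟩
  -- Count edges by sending each non-root vertex to its parent edge; the strict descent of `rank`
  -- keeps an edge from being the parent edge of both its ends.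
  have hbij : Nat.card {x // x ≠ root} = Nat.card G.edgeSet := by
    refine Nat.card_congr (Equiv.ofBijective
      (fun x => ⟨s(x.1, par x.1), (hpar x.1 x.2).1⟩) ⟨?_, ?_⟩)
    · rintro ⟨x, hx⟩ ⟨y, hy⟩ h
      rcases Sym2.eq_iff.1 (congrArg Subtype.val h) with h | h
      · exact Subtype.ext h.1
      · have h1 := (hpar x hx).2
        have h2 := (hpar y hy).2
        rw [h.2] at h1
        rw [← h.1] at h2
        exact absurd h1 h2.not_gt
    · rintro ⟨e, he⟩
      induction e using Sym2.ind with
      | _ x y =>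
        rcases huniq x y he with h | h
        · exact ⟨⟨x, h.1⟩, by simp [h.2]⟩
        · exact ⟨⟨y, h.1⟩, by simp [h.2, Sym2.eq_swap]⟩
  rw [← hbij]
  have := Fintype.ofFinite V
  simp only [ne_eq, Nat.card_eq_fintype_card, Fintype.card_subtype_compl, Fintype.card_unique]
  have : 0 < Fintype.card V := Fintype.card_pos_iff.2 ⟨root⟩
  omega

end SimpleGraph

/-! ### Locally bijective maps between trees. -/

namespace SimpleGraph

variable {V W : Type*} {G : SimpleGraph V} {H : SimpleGraph W}

section Cover

variable {f : V → W} {y : V} {r : ℕ}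

/-- Images of geodesics cannot turn back: otherwise `f z` would be the parent of `f p`, which is
already the image of the parent `q` of `p`, against injectivity around `p`. -/
lemma IsTree.dist_map_eq (hG : G.IsTree) (hH : H.IsTree)
    (hf : ∀ z, G.dist y z < r → Set.BijOn f (G.neighborSet z) (H.neighborSet (f z))) {z : V}
    (hz : G.dist y z ≤ r) : H.dist (f y) (f z) = G.dist y z := by
  induction hn : G.dist y z using Nat.strong_induction_on generalizing z with
  | _ n ih =>
    subst hn
    by_cases h : z = y
    · simp [h]
    obtain ⟨p, hp, hd⟩ := hG.connected.exists_adj_dist_add_one h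
    have ihp := ih _ (by omega) (by omega) (rfl : G.dist y p = _)
    have hzp := (hf p (by omega)).mapsTo (show z ∈ G.neighborSet p from hp.symm)
    rcases hH.dist_eq_dist_add_one_of_adj (f y) hzp with h2 | h2
    · by_cases hpy : p = y
      · subst hpy
        simp at h2
      obtain ⟨q, hq, hdq⟩ := hG.connected.exists_adj_dist_add_one hpy
      have ihq := ih _ (by omega) (by omega) (rfl : G.dist y q = _)
      have hqp := (hf p (by omega)).mapsTo (show q ∈ G.neighborSet p from hq)
      have heq := hH.eq_of_adj_of_dist_add_one (u := f y) hzp hqp (by omega) (by omega)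
      have : z = q := (hf p (by omega)).injOn (show z ∈ G.neighborSet p from hp.symm) hq heq
      subst this
      omega
    · omega

lemma IsTree.injOn_of_bijOn_neighborSet (hG : G.IsTree) (hH : H.IsTree)
    (hf : ∀ z, G.dist y z < r → Set.BijOn f (G.neighborSet z) (H.neighborSet (f z))) {z z' : V}
    (hz : G.dist y z ≤ r) (hz' : G.dist y z' ≤ r) (h : f z = f z') : z = z' := by
  have hdz := hG.dist_map_eq hH hf hz
  have hdz' := hG.dist_map_eq hH hf hz'
  induction hn : G.dist y z generalizing z z' with
  | zero =>
    have h1 := hG.connected.dist_eq_zero_iff.1 hn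
    have h2 : G.dist y z' = 0 := by rw [← hdz', ← h, hdz, hn]
    rw [← h1, ← hG.connected.dist_eq_zero_iff.1 h2]
  | succ n ih =>
    have hn' : G.dist y z' = n + 1 := by rw [← hdz', ← h, hdz, hn]
    have hzy : z ≠ y := by rintro rfl; simp at hn
    have hzy' : z' ≠ y := by rintro rfl; simp at hn'
    obtain ⟨p, hp, hd⟩ := hG.connected.exists_adj_dist_add_one hzy
    obtain ⟨p', hp', hd'⟩ := hG.connected.exists_adj_dist_add_one hzy'
    have h1 := hG.dist_map_eq hH hf (z := p) (by omega)
    have h2 := hG.dist_map_eq hH hf (z := p') (by omega)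
    have hzp := (hf p (by omega)).mapsTo (show z ∈ G.neighborSet p from hp.symm)
    have hzp' := (hf p' (by omega)).mapsTo (show z' ∈ G.neighborSet p' from hp'.symm)
    have heq : f p = f p' := hH.eq_of_adj_of_dist_add_one (u := f y) (Adj.symm hzp)
      (h ▸ Adj.symm hzp') (by omega) (by rw [h]; omega)
    obtain rfl := ih (by omega) (by omega) heq h1 h2 (by omega)
    exact (hf p (by omega)).injOn hp.symm hp'.symm h

lemma IsTree.exists_map_eq (hG : G.IsTree) (hH : H.IsTree)
    (hf : ∀ z, G.dist y z < r → Set.BijOn f (G.neighborSet z) (H.neighborSet (f z))) {w : W}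
    (hw : H.dist (f y) w ≤ r) : ∃ z, G.dist y z ≤ r ∧ f z = w := by
  induction hn : H.dist (f y) w generalizing w with
  | zero => exact ⟨y, by simp, hH.connected.dist_eq_zero_iff.1 hn⟩
  | succ n ih =>
    have hwy : w ≠ f y := by rintro rfl; simp at hn
    obtain ⟨p, hp, hd⟩ := hH.connected.exists_adj_dist_add_one hwy
    obtain ⟨q, hq, rfl⟩ := ih (w := p) (by omega) (by omega)
    have h1 := hG.dist_map_eq hH hf hq
    obtain ⟨z, hz, rfl⟩ := (hf q (by omega)).surjOn (show w ∈ H.neighborSet (f q) from hp.symm)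
    have ht := hG.connected.dist_triangle (u := y) (v := q) (w := z)
    rw [dist_eq_one_iff_adj.2 hz] at ht
    exact ⟨z, by omega, rfl⟩

/-- Adjacent vertices of a tree are never equidistant from the center, so an edge within the ball
has an end in its interior, where `f` is bijective on neighbors. -/
lemma IsTree.adj_map_iff (hG : G.IsTree) (hH : H.IsTree)
    (hf : ∀ z, G.dist y z < r → Set.BijOn f (G.neighborSet z) (H.neighborSet (f z))) {z z' : V}
    (hz : G.dist y z ≤ r) (hz' : G.dist y z' ≤ r) : H.Adj (f z) (f z') ↔ G.Adj z z' := by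
  have aux : ∀ {z z' : V}, G.dist y z < r → G.dist y z' ≤ r →
      (H.Adj (f z) (f z') ↔ G.Adj z z') := by
    intro z z' hz hz'
    refine ⟨fun h => ?_, fun h => (hf z hz).mapsTo h⟩
    obtain ⟨x, hx, hxe⟩ := (hf z hz).surjOn h
    have ht := hG.connected.dist_triangle (u := y) (v := z) (w := x)
    rw [dist_eq_one_iff_adj.2 hx] at ht
    exact hG.injOn_of_bijOn_neighborSet hH hf (by omega) hz' hxe ▸ hx
  by_cases h : G.dist y z < r
  · exact aux h hz'
  by_cases h' : G.dist y z' < r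
  · rw [H.adj_comm, G.adj_comm]
    exact aux h' hz
  have h1 : G.dist y z = G.dist y z' := by omega
  have h2 : H.dist (f y) (f z) = H.dist (f y) (f z') := by
    rw [hG.dist_map_eq hH hf hz, hG.dist_map_eq hH hf hz', h1]
  exact ⟨fun h => absurd h2 (hH.dist_ne_of_adj _ h), fun h => absurd h1 (hG.dist_ne_of_adj _ h)⟩

end Cover

end SimpleGraph

/-! ### Views and the relaxed verifier. -/

namespace Mending

universe u v

variable {S : Type u} {Γ : Type v} {r : ℕ}

lemma InputGraph.mem_ball {G : InputGraph S} (hG : G.graph.Connected) {x w : G.V} :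
    w ∈ G.ball x r ↔ G.graph.dist x w ≤ r := by
  rw [InputGraph.ball, Set.mem_ofPred_eq, ← (hG.preconnected x w).coe_dist_eq_edist, Nat.cast_le]

lemma InputGraph.self_mem_ball {G : InputGraph S} (x : G.V) : x ∈ G.ball x r := by
  simp [InputGraph.ball]

lemma SameView.symm {G G' : InputGraph S} {out : G.V → Γ} {out' : G'.V → Γ} {x : G.V} {x' : G'.V}
    (h : SameView r G out x G' out' x') : SameView r G' out' x' G out x := by
  obtain ⟨e, h1, h2, h3⟩ := h
  refine ⟨e.symm, fun w hw => ?_, fun w => ?_, fun w => ?_⟩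
  · have hx : e ⟨x, G.self_mem_ball x⟩ = w := Subtype.ext ((h1 _ rfl).trans hw.symm)
    rw [← hx]
    simp
  · have := h2 (e.symm w)
    simp only [RelIso.apply_symm_apply] at this
    exact this.symm
  · have := h3 (e.symm w)
    simp only [RelIso.apply_symm_apply] at this
    exact this.symm

/-- The relaxed verifier is local. -/
lemma Verifier.IsLocal.star {ψ : Verifier S Γ} {𝒢 : Set (InputGraph S)} (h : ψ.IsLocal 𝒢 r) :
    (ψ.star r).IsLocal 𝒢 r := by
  have aux : ∀ G ∈ 𝒢, ∀ G' ∈ 𝒢, ∀ (out : G.V → Option Γ) (out' : G'.V → Option Γ) (x : G.V)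
      (x' : G'.V), SameView r G out x G' out' x' → ψ.star r G out x → ψ.star r G' out' x' := by
    rintro G hG G' hG' out out' x x' ⟨e, h1, h2, h3⟩ (⟨w, hw, hn⟩ | ⟨o, ho, hψ⟩)
    · exact Or.inl ⟨e ⟨w, hw⟩, (e ⟨w, hw⟩).2, by rw [h3, hn]⟩
    · right
      have hsome : ∀ w : G'.ball x' r, out' w = some (o (e.symm w)) := by
        intro w
        have := h3 (e.symm w)
        simp only [RelIso.apply_symm_apply] at this
        rw [this, ho _ (e.symm w).2]
      have : Nonempty Γ := ⟨o x⟩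
      refine ⟨fun w => (out' w).getD (Classical.arbitrary Γ), fun w hw => ?_, ?_⟩
      · have := hsome ⟨w, hw⟩
        simp only at this
        simp [this]
      · refine (h G hG G' hG' o _ x x' ⟨e, h1, h2, fun w => ?_⟩).1 hψ
        rw [hsome (e w)]
        simp
  exact fun G hG G' hG' out out' x x' hv =>
    ⟨aux G hG G' hG' out out' x x' hv, aux G' hG' G hG out' out x' x hv.symm⟩

/-- The relaxed verifier only looks at the labels within distance `r`. -/
lemma Verifier.star_congr {ψ : Verifier S Γ} {𝒢 : Set (InputGraph S)} (h : ψ.IsLocal 𝒢 r)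
    {G : InputGraph S} (hG : G ∈ 𝒢) {out out' : G.V → Option Γ} {x : G.V}
    (hout : ∀ w ∈ G.ball x r, out' w = out w) : ψ.star r G out x ↔ ψ.star r G out' x :=
  h.star G hG G hG out out' x x
    ⟨RelIso.refl _, fun _ hw => hw, fun _ => rfl, fun w => hout w w.2⟩

/-- A map between trees that is bijective on neighborhoods yields isomorphic views. -/
lemma SameView.of_bijOn_neighborSet {G H : InputGraph S} (hG : G.graph.IsTree)
    (hH : H.graph.IsTree) {f : G.V → H.V} {y : G.V} {out : G.V → Γ} {out' : H.V → Γ}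
    (hf : ∀ z, G.graph.dist y z < r →
      Set.BijOn f (G.graph.neighborSet z) (H.graph.neighborSet (f z)))
    (hin : ∀ z, G.graph.dist y z ≤ r → H.input (f z) = G.input z)
    (hout : ∀ z, G.graph.dist y z ≤ r → out' (f z) = out z) :
    SameView r G out y H out' (f y) := by
  have hb : ∀ z : G.ball y r, G.graph.dist y z ≤ r := fun z =>
    (InputGraph.mem_ball hG.connected).1 z.2
  have hmaps : ∀ z : G.ball y r, f z ∈ H.ball (f y) r := fun z => by
    rw [InputGraph.mem_ball hH.connected, hG.dist_map_eq hH hf (hb z)]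
    exact hb z
  let F : G.ball y r → H.ball (f y) r := fun z => ⟨f z, hmaps z⟩
  have hF : Function.Bijective F := by
    constructor
    · intro z z' h
      exact Subtype.ext (hG.injOn_of_bijOn_neighborSet hH hf (hb z) (hb z')
        (congrArg Subtype.val h))
    · rintro ⟨w, hw⟩
      obtain ⟨z, hz, rfl⟩ := hG.exists_map_eq hH hf ((InputGraph.mem_ball hH.connected).1 hw)
      exact ⟨⟨z, (InputGraph.mem_ball hG.connected).2 hz⟩, rfl⟩
  refine ⟨⟨Equiv.ofBijective F hF, ?_⟩, ?_, fun w => hin w (hb w), fun w => hout w (hb w)⟩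
  · intro z z'
    exact hG.adj_map_iff hH hf (hb z) (hb z')
  · rintro w hw
    exact congrArg f hw

end Mending

/-! ### Critical vertices and their branching. -/

namespace Mending

universe u v

open SimpleGraph

variable {S : Type u} {Γ : Type v}

/-- On `D`, the relaxed verifier is happy with `μ`, and `μ` has no more holes than `old`. -/
def GoodOn (ψ : Verifier S Γ) (r : ℕ) (G : InputGraph S) (old : G.V → Option Γ) (D : Set G.V)
    (μ : G.V → Option Γ) : Prop :=
  ∀ x ∈ D, ψ.star r G μ x ∧ (μ x = none → old x = none)

/-- The labels of `μ` near `u` extend to a labeling that is good on the descendants of `u` and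
that coincides with `old` on those descendants whose depth exceeds `t`. -/
def Extends (ψ : Verifier S Γ) (r : ℕ) (G : InputGraph S) (old : G.V → Option Γ) (v : G.V) (t : ℕ)
    (u : G.V) (μ : G.V → Option Γ) : Prop :=
  ∃ μ' : G.V → Option Γ, (∀ z ∈ G.ball u r, μ' z = μ z) ∧
    GoodOn ψ r G old (G.graph.desc v u) μ' ∧
    ∀ z ∈ G.graph.desc v u, t < G.graph.dist v z → μ' z = old z

/-- Some labeling that is good on the descendants of `u` cannot be replaced by one that changes
`old` only up to depth `t`. -/
def Critical (ψ : Verifier S Γ) (r : ℕ) (G : InputGraph S) (old : G.V → Option Γ) (v : G.V)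
    (t : ℕ) (u : G.V) : Prop :=
  ∃ μ, GoodOn ψ r G old (G.graph.desc v u) μ ∧ ¬ Extends ψ r G old v t u μ

variable {ψ : Verifier S Γ} {r : ℕ} {𝒢 : Set (InputGraph S)} {G : InputGraph S}
  {old : G.V → Option Γ} {v : G.V} {t : ℕ}

lemma Extends.congr {u : G.V} {μ ν : G.V → Option Γ} (h : Extends ψ r G old v t u μ)
    (hν : ∀ z ∈ G.ball u r, μ z = ν z) : Extends ψ r G old v t u ν := by
  obtain ⟨μ', h1, h2, h3⟩ := h
  exact ⟨μ', fun z hz => (h1 z hz).trans (hν z hz), h2, h3⟩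

lemma extends_old (hold : (ψ.star r).Accepts G old) (u : G.V) : Extends ψ r G old v t u old :=
  ⟨old, fun _ _ => rfl, fun x _ => ⟨hold x, id⟩, fun _ _ _ => rfl⟩

/-- Extensions below all children of `u` combine to an extension below `u`. -/
lemma extends_of_isChild (hψ : ψ.IsLocal 𝒢 r) (hG : G ∈ 𝒢) (hT : G.graph.IsTree) {u : G.V}
    {μ : G.V → Option Γ} (hut : G.graph.dist v u ≤ t) (hstar : ψ.star r G μ u)
    (hhole : μ u = none → old u = none)
    (hw : ∀ w, G.graph.IsChild v u w → Extends ψ r G old v t w μ) :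
    Extends ψ r G old v t u μ := by
  classical
  choose! M hM1 hM2 hM3 using hw
  have hc := hT.connected
  let μ' : G.V → Option Γ := fun z =>
    if h : ∃ w, G.graph.IsChild v u w ∧ z ∈ G.graph.desc v w then M h.choose z else μ z
  have hin : ∀ w, G.graph.IsChild v u w → ∀ z ∈ G.graph.desc v w, μ' z = M w z := by
    intro w hw z hz
    have h : ∃ w, G.graph.IsChild v u w ∧ z ∈ G.graph.desc v w := ⟨w, hw, hz⟩
    have heq : h.choose = w := by
      by_contra hne
      exact Set.disjoint_left.1 (hT.desc_disjoint
        (by rw [h.choose_spec.1.2, hw.2]) hne) h.choose_spec.2 hz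
    change (if h : _ then _ else _) = _
    rw [dif_pos h, heq]
  -- A node below a sibling `w'` is nearer to `w'` than to `w`, so it lies in the ball where `M w'`
  -- still agrees with `μ`. Thus views from below `w` do not notice the gluing.
  have hnear : ∀ w, G.graph.IsChild v u w → ∀ z, z ∉ G.graph.desc v w →
      G.graph.dist w z ≤ r → μ' z = μ z := by
    intro w hw z hz hd
    by_cases h : ∃ w, G.graph.IsChild v u w ∧ z ∈ G.graph.desc v w
    · obtain ⟨w', hw', hz'⟩ := h
      rw [hin w' hw' z hz']
      refine hM1 w' hw' z ((InputGraph.mem_ball hc).2 ?_)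
      have hne : w' ≠ w := by rintro rfl; exact hz hz'
      have := hT.dist_of_mem_desc hz' (hT.not_mem_desc_of_dist_le (by rw [hw.2, hw'.2]) hne.symm)
      rw [dist_comm] at hd ⊢
      omega
    · exact dif_neg h
  have hball : ∀ z ∈ G.ball u r, μ' z = μ z := by
    intro z hz
    rw [InputGraph.mem_ball hc] at hz
    by_cases h : ∃ w, G.graph.IsChild v u w ∧ z ∈ G.graph.desc v w
    · obtain ⟨w', hw', hz'⟩ := h
      rw [hin w' hw' z hz']
      refine hM1 w' hw' z ((InputGraph.mem_ball hc).2 ?_)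
      have := hT.dist_of_mem_desc hz' (hw'.not_mem_desc hT)
      rw [dist_comm] at hz ⊢
      omega
    · exact dif_neg h
  have hself : u ∈ G.ball u r := InputGraph.self_mem_ball u
  refine ⟨μ', hball, fun x hx => ?_, fun z hz hzt => ?_⟩
  · by_cases hxu : x = u
    · subst hxu
      exact ⟨(Verifier.star_congr hψ hG hball).1 hstar, fun h => hhole (hball x hself ▸ h)⟩
    · obtain ⟨w, hw, hxw⟩ := hT.exists_isChild_of_mem_desc hx hxu
      refine ⟨(Verifier.star_congr hψ hG fun z hz => ?_).1 (hM2 w hw x hxw).1,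
        fun h => (hM2 w hw x hxw).2 (hin w hw x hxw ▸ h)⟩
      by_cases hzw : z ∈ G.graph.desc v w
      · exact hin w hw z hzw
      · rw [InputGraph.mem_ball hc, hT.dist_of_mem_desc hxw hzw] at hz
        rw [hnear w hw z hzw (by omega), hM1 w hw z ((InputGraph.mem_ball hc).2 (by omega))]
  · by_cases hzu : z = u
    · subst hzu
      omega
    · obtain ⟨w, hw, hzw⟩ := hT.exists_isChild_of_mem_desc hz hzu
      rw [hin w hw z hzw, hM3 w hw z hzw hzt]

lemma GoodOn.mono {D D' : Set G.V} {μ : G.V → Option Γ} (h : GoodOn ψ r G old D μ)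
    (hD : D' ⊆ D) : GoodOn ψ r G old D' μ := fun x hx => h x (hD hx)

lemma extends_of_not_critical {u : G.V} {μ : G.V → Option Γ} (h : ¬ Critical ψ r G old v t u)
    (hμ : GoodOn ψ r G old (G.graph.desc v u) μ) : Extends ψ r G old v t u μ := by
  by_contra hcon
  exact h ⟨μ, hμ, hcon⟩

lemma Critical.exists_isChild (hψ : ψ.IsLocal 𝒢 r) (hG : G ∈ 𝒢) (hT : G.graph.IsTree) {u : G.V}
    (hut : G.graph.dist v u ≤ t) (h : Critical ψ r G old v t u) :
    ∃ w, G.graph.IsChild v u w ∧ Critical ψ r G old v t w := by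
  by_contra! hcon
  obtain ⟨μ, hμ, hE⟩ := h
  obtain ⟨h1, h2⟩ := hμ u (mem_desc_self v u)
  exact hE (extends_of_isChild hψ hG hT hut h1 h2 fun w hw =>
    extends_of_not_critical (hcon w hw) (hμ.mono (hT.desc_subset hw.mem_desc)))

/-- A descending path of length `L` along which every vertex has exactly one critical child. -/
structure CriticalPath (ψ : Verifier S Γ) (r : ℕ) (G : InputGraph S) (old : G.V → Option Γ)
    (v : G.V) (t L : ℕ) (p : ℕ → G.V) : Prop where
  start : Critical ψ r G old v t (p 0)
  depth : G.graph.dist v (p 0) + L ≤ t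
  isChild : ∀ a < L, G.graph.IsChild v (p a) (p (a + 1))
  unique : ∀ a < L, ∀ w, G.graph.IsChild v (p a) w → Critical ψ r G old v t w → w = p (a + 1)

/-- Without long critical paths, the critical vertices branch exponentially. -/
lemma Critical.two_pow_le_ncard_desc (hψ : ψ.IsLocal 𝒢 r) (hG : G ∈ 𝒢) (hT : G.graph.IsTree)
    {L : ℕ} (hL : ∀ p, ¬ CriticalPath ψ r G old v t L p) (m : ℕ) {u : G.V}
    (hu : Critical ψ r G old v t u) (hd : G.graph.dist v u + m * L ≤ t) :
    2 ^ m ≤ (G.graph.desc v u).ncard := by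
  classical
  induction m generalizing u with
  | zero =>
    rw [pow_zero, Nat.one_le_iff_ne_zero]
    exact (Set.ncard_pos (Set.toFinite _)).2 ⟨u, mem_desc_self v u⟩ |>.ne'
  | succ m ih =>
    let next : G.V → G.V := fun x =>
      if h : ∃ w, G.graph.IsChild v x w ∧ Critical ψ r G old v t w then h.choose else x
    let p : ℕ → G.V := fun a => next^[a] u
    have hp : ∀ a, Critical ψ r G old v t (p a) → G.graph.dist v (p a) ≤ t →
        G.graph.IsChild v (p a) (p (a + 1)) ∧ Critical ψ r G old v t (p (a + 1)) := by
      intro a ha hat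
      have h := ha.exists_isChild hψ hG hT hat
      have : p (a + 1) = h.choose := by
        change next^[a + 1] u = _
        rw [Function.iterate_succ_apply']
        exact dif_pos h
      rw [this]
      exact h.choose_spec
    rw [Nat.succ_mul] at hd
    have key : ∀ a ≤ L, Critical ψ r G old v t (p a) ∧
        G.graph.dist v (p a) = G.graph.dist v u + a ∧ p a ∈ G.graph.desc v u := by
      intro a
      induction a with
      | zero => exact fun _ => ⟨hu, rfl, mem_desc_self v u⟩
      | succ a iha =>
        intro ha
        obtain ⟨h1, h2, h3⟩ := iha (by omega)
        obtain ⟨h4, h5⟩ := hp a h1 (by omega)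
        exact ⟨h5, by rw [h4.2, h2, add_assoc], hT.desc_subset h3 h4.mem_desc⟩
    -- The descent `p` is not a critical path, so a second critical child appears within `L` steps;
    -- both subtrees, which are disjoint, receive the induction hypothesis.
    have hex : ∃ a < L, ∃ w, G.graph.IsChild v (p a) w ∧ Critical ψ r G old v t w ∧
        w ≠ p (a + 1) := by
      by_contra! hcon
      refine hL p ⟨hu, ?_, fun a ha => ?_, fun a ha w hw hwc => hcon a ha w hw hwc⟩
      · change G.graph.dist v u + L ≤ t
        omega
      · obtain ⟨h1, h2, h3⟩ := key a ha.le
        exact (hp a h1 (by omega)).1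
    obtain ⟨a, ha, w, hw, hwc, hne⟩ := hex
    obtain ⟨h1, h2, h3⟩ := key a ha.le
    obtain ⟨h4, h5⟩ := hp a h1 (by omega)
    have i1 := ih hwc (by rw [hw.2]; omega)
    have i2 := ih h5 (by rw [h4.2]; omega)
    have hdis := hT.desc_disjoint (v := v) (by rw [hw.2, h4.2]) hne
    have hsub : G.graph.desc v w ∪ G.graph.desc v (p (a + 1)) ⊆ G.graph.desc v u :=
      Set.union_subset (hT.desc_subset (hT.desc_subset h3 hw.mem_desc))
        (hT.desc_subset (hT.desc_subset h3 h4.mem_desc))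
    have := Set.ncard_le_ncard hsub (Set.toFinite _)
    rw [Set.ncard_union_eq hdis (Set.toFinite _) (Set.toFinite _)] at this
    rw [pow_succ]
    omega

/-- If `old` has a mend at `v` but no `t`-mend, then the root `v` is critical. -/
lemma Verifier.IsMend.critical (hT : G.graph.IsTree) {s : ℕ} {new : G.V → Option Γ}
    (hnew : ψ.IsMend r G s v old new) (ht : ∀ μ, ¬ ψ.IsMend r G t v old μ) :
    Critical ψ r G old v t v := by
  refine ⟨new, fun x _ => ⟨hnew.accepts x, hnew.no_new_hole x⟩, ?_⟩
  rintro ⟨μ, h1, h2, h3⟩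
  rw [desc_root] at h2 h3
  refine ht μ ⟨fun x => (h2 x trivial).1, ?_, fun x => (h2 x trivial).2, fun w hw => ?_⟩
  · rw [h1 v (InputGraph.self_mem_ball v)]
    exact hnew.filled
  · rw [InputGraph.mem_ball hT.connected]
    by_contra! hcon
    exact hw (h3 w trivial hcon)

/-- Without critical paths of length `L`, logarithmic mends exist. -/
lemma exists_isMend_of_not_criticalPath (hψ : ψ.IsLocal 𝒢 r) (hG : G ∈ 𝒢) (hT : G.graph.IsTree)
    {L s : ℕ} {new : G.V → Option Γ} (hnew : ψ.IsMend r G s v old new)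
    (hL : ∀ t p, ¬ CriticalPath ψ r G old v t L p) :
    ∃ μ, ψ.IsMend r G ((Nat.log 2 (Nat.card G.V) + 1) * L) v old μ := by
  by_contra! hcon
  have h := (hnew.critical hT hcon).two_pow_le_ncard_desc hψ hG hT (hL _)
    (Nat.log 2 (Nat.card G.V) + 1) (by simp)
  rw [desc_root, Set.ncard_univ] at h
  exact absurd h (Nat.lt_pow_succ_log_self one_lt_two _).not_ge

end Mending

/-! ### Segments of a rooted tree and their repetition. -/

namespace SimpleGraph

variable {V : Type*}

/-- A segment of the tree `G` rooted at `v`, leading from `a` down to `b`, whose ends have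
isomorphic neighborhoods of radius `r`. -/
structure Segment (G : SimpleGraph V) (v : V) (r : ℕ) where
  /-- the upper end -/
  a : V
  /-- the lower end -/
  b : V
  /-- the parent of the upper end -/
  pa : V
  /-- the parent of the lower end -/
  pb : V
  /-- the isomorphism from the neighborhood of `a` to that of `b` -/
  φ : V → V
  /-- the inverse of `φ` -/
  φ' : V → V
  isChild_a : G.IsChild v pa a
  isChild_b : G.IsChild v pb b
  pb_mem : pb ∈ G.desc v a
  lt_dist : r < G.dist a b
  dist_φ : ∀ z, G.dist a z ≤ r → G.dist b (φ z) = G.dist a z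
  dist_φ' : ∀ z, G.dist b z ≤ r → G.dist a (φ' z) = G.dist b z
  φ'_φ : ∀ z, G.dist a z ≤ r → φ' (φ z) = z
  φ_φ' : ∀ z, G.dist b z ≤ r → φ (φ' z) = z
  φ_mem : ∀ z, G.dist a z ≤ r → (φ z ∈ G.desc v b ↔ z ∈ G.desc v a)
  adj_φ : ∀ z z', G.dist a z ≤ r → G.dist a z' ≤ r → (G.Adj (φ z) (φ z') ↔ G.Adj z z')

namespace Segment

variable {G : SimpleGraph V} {v : V} {r : ℕ} (s : G.Segment v r)

/-- The vertices of the segment, with everything that hangs from it. -/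
def block : Set V := G.desc v s.a \ G.desc v s.b

lemma φ_a (hG : G.IsTree) : s.φ s.a = s.b := by
  have := s.dist_φ s.a (by simp)
  rw [dist_self, hG.connected.dist_eq_zero_iff] at this
  exact this.symm

lemma φ'_b (hG : G.IsTree) : s.φ' s.b = s.a := by
  rw [← s.φ_a hG, s.φ'_φ _ (by simp)]

lemma b_mem (hG : G.IsTree) : s.b ∈ G.desc v s.a := hG.desc_subset s.pb_mem s.isChild_b.mem_desc

lemma dist_root_b (hG : G.IsTree) : G.dist v s.b = G.dist v s.a + G.dist s.a s.b := s.b_mem hG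

lemma a_mem_block (hG : G.IsTree) : s.a ∈ s.block := by
  have := s.dist_root_b hG
  have := s.lt_dist
  exact ⟨mem_desc_self _ _, hG.not_mem_desc_of_dist_le (by omega)
    fun h => by rw [← h, dist_self] at this; omega⟩

lemma pb_mem_block (hG : G.IsTree) : s.pb ∈ s.block := ⟨s.pb_mem, s.isChild_b.not_mem_desc hG⟩

lemma pa_notMem (hG : G.IsTree) : s.pa ∉ G.desc v s.a := s.isChild_a.not_mem_desc hG

lemma b_notMem_block : s.b ∉ s.block := fun h => h.2 (mem_desc_self _ _)

/-- As `r < dist a b`, the ball around one end of the segment does not run past the other end. This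
is why views in the pumped tree meet only adjacent copies. -/
lemma mem_block_of_dist_a (hG : G.IsTree) {z : V} (hz : z ∈ G.desc v s.a)
    (hd : G.dist s.a z ≤ r) : z ∈ s.block := by
  refine ⟨hz, fun h => ?_⟩
  have h1 := hG.dist_of_mem_desc h (s.a_mem_block hG).2
  have h2 := s.lt_dist
  rw [dist_comm, dist_comm (u := s.b)] at h1
  omega

lemma mem_block_of_dist_b (hG : G.IsTree) {z : V} (hz : z ∉ G.desc v s.b)
    (hd : G.dist s.b z ≤ r) : z ∈ s.block := by
  refine ⟨?_, hz⟩
  by_contra h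
  have h1 := hG.dist_of_mem_desc (s.b_mem hG) h
  have h2 := s.lt_dist
  rw [dist_comm] at h2
  omega

/-- `φ` preserves adjacency and descent, and the parent is the only neighbor of `b` that is not a
descendant. -/
lemma φ_pa (hG : G.IsTree) (hr : 0 < r) : s.φ s.pa = s.pb := by
  have h1 : G.dist s.a s.pa ≤ r := by rw [dist_eq_one_iff_adj.2 s.isChild_a.1.symm]; omega
  have h2 : G.Adj s.b (s.φ s.pa) := by
    have := (s.adj_φ s.a s.pa (by simp) h1).2 s.isChild_a.1.symm
    rwa [s.φ_a hG] at this
  have h3 := (s.φ_mem s.pa h1).not.2 (s.pa_notMem hG)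
  exact hG.isChild_unique (hG.desc_exit (mem_desc_self _ _) h3 h2).2 s.isChild_b

lemma bijOn_φ (hG : G.IsTree) {z : V} (hz : G.dist s.a z < r) :
    Set.BijOn s.φ (G.neighborSet z) (G.neighborSet (s.φ z)) := by
  have hn : ∀ {x z y}, G.dist x z < r → G.Adj z y → G.dist x y ≤ r := by
    intro x z y hx hzy
    have ht := hG.connected.dist_triangle (u := x) (v := z) (w := y)
    rw [dist_eq_one_iff_adj.2 hzy] at ht
    omega
  refine ⟨fun y hy => (s.adj_φ z y hz.le (hn hz hy)).2 hy, fun y hy y' hy' h => ?_, fun y hy => ?_⟩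
  · rw [← s.φ'_φ y (hn hz hy), h, s.φ'_φ y' (hn hz hy')]
  · have hb : G.dist s.b (s.φ z) < r := by rwa [s.dist_φ z hz.le]
    have hy' := hn hb hy
    refine ⟨s.φ' y, (s.adj_φ z _ hz.le ?_).1 ?_, s.φ_φ' y hy'⟩
    · rwa [s.dist_φ' y hy']
    · rwa [s.φ_φ' y hy']

/-- The tree that consists of `N` consecutive copies of the segment. -/
def pump (N : ℕ) : SimpleGraph (Fin N × s.block) where
  Adj x y := (x.1 = y.1 ∧ G.Adj x.2 y.2) ∨
    (x.1.val + 1 = y.1.val ∧ x.2.val = s.pb ∧ y.2.val = s.a) ∨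
    (y.1.val + 1 = x.1.val ∧ y.2.val = s.pb ∧ x.2.val = s.a)
  symm := ⟨fun x y h => by
    rcases h with ⟨h1, h2⟩ | h | h
    · exact Or.inl ⟨h1.symm, h2.symm⟩
    · exact Or.inr (Or.inr h)
    · exact Or.inr (Or.inl h)⟩
  loopless := ⟨fun x h => by
    rcases h with ⟨h1, h2⟩ | ⟨h, _⟩ | ⟨h, _⟩
    · exact G.irrefl h2
    · omega
    · omega⟩

variable {N : ℕ}

lemma pump_isTree [Finite V] (hG : G.IsTree) (hN : 0 < N) : (s.pump N).IsTree := by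
  classical
  have hex : ∀ y : s.block, y.val ≠ s.a → ∃ p : s.block, G.IsChild v p y := by
    rintro ⟨y, hy⟩ hya
    have hyv : y ≠ v := by
      rintro rfl
      exact hG.not_mem_desc_of_dist_le (by simp) hya hy.1
    obtain ⟨p, hp, hd⟩ := hG.connected.exists_adj_dist_add_one hyv
    exact ⟨⟨p, hG.mem_desc_of_adj hy.1 hp (Or.inl hya), fun h =>
      hy.2 (hG.mem_desc_of_adj h hp.symm (Or.inr hd.symm))⟩, hp.symm, hd.symm⟩
  choose! par hpar using hex
  let P : Fin N × s.block → Fin N × s.block := fun x =>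
    if x.2.val = s.a then (⟨x.1.val - 1, by omega⟩, ⟨s.pb, s.pb_mem_block hG⟩) else (x.1, par x.2)
  have hPa : ∀ x, x.2.val = s.a →
      P x = (⟨x.1.val - 1, by omega⟩, ⟨s.pb, s.pb_mem_block hG⟩) := fun x h => if_pos h
  have hPn : ∀ x, x.2.val ≠ s.a → P x = (x.1, par x.2) := fun x h => if_neg h
  have huniq : ∀ x y : Fin N × s.block, x.1 = y.1 → G.IsChild v x.2 y.2 →
      y ≠ (⟨0, hN⟩, ⟨s.a, s.a_mem_block hG⟩) ∧ x = P y := by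
    intro x y h1 h2
    have hya : y.2.val ≠ s.a := by
      intro h
      rw [h] at h2
      exact s.pa_notMem hG (hG.isChild_unique h2 s.isChild_a ▸ x.2.2.1)
    refine ⟨fun h => hya (by rw [h]), ?_⟩
    rw [hPn y hya]
    exact Prod.ext h1 (Subtype.ext (hG.isChild_unique h2 (hpar y.2 hya)))
  have huniq' : ∀ x y : Fin N × s.block, x.1.val + 1 = y.1.val → x.2.val = s.pb →
      y.2.val = s.a → y ≠ (⟨0, hN⟩, ⟨s.a, s.a_mem_block hG⟩) ∧ x = P y := by
    intro x y h1 h2 h3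
    refine ⟨fun h => ?_, ?_⟩
    · rw [h] at h1
      simp at h1
    · rw [hPa y h3]
      exact Prod.ext (Fin.ext (by simp only; omega)) (Subtype.ext h2)
  -- Shifting by `dist v b` per copy makes the rank drop across a junction too, as `pb` is one level
  -- above `b`.
  refine isTree_of_rank (⟨0, hN⟩, ⟨s.a, s.a_mem_block hG⟩)
    (fun x => x.1.val * G.dist v s.b + G.dist v x.2) P (fun x hx => ?_) (fun x y h => ?_)
  · by_cases hxa : x.2.val = s.a
    · have h0 : x.1.val ≠ 0 := fun h => hx (Prod.ext (Fin.ext h) (Subtype.ext hxa))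
      rw [hPa x hxa]
      refine ⟨Or.inr (Or.inr ⟨by simp only; omega, rfl, hxa⟩), ?_⟩
      obtain ⟨k, hk⟩ := Nat.exists_eq_succ_of_ne_zero h0
      have := s.isChild_b.2
      simp only [hk, Nat.succ_eq_add_one, Nat.add_sub_cancel, Nat.succ_mul]
      omega
    · rw [hPn x hxa]
      have := hpar x.2 hxa
      exact ⟨Or.inl ⟨rfl, this.1.symm⟩, by have := this.2; simp only; omega⟩
  · rcases h with ⟨h1, h2⟩ | h | h
    · rcases hG.isChild_or_isChild v h2 with h2 | h2
      · exact Or.inr (huniq x y h1 h2)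
      · exact Or.inl (huniq y x h1.symm h2)
    · exact Or.inr (huniq' x y h.1 h.2.1 h.2.2)
    · exact Or.inl (huniq' y x h.1 h.2.1 h.2.2)

/-- Each junction edge takes the place of an edge of `G`: of the edge to `b` at its upper end `pb`,
and of the edge to `pa` at its lower end `a`. -/
lemma ncard_neighborSet_pump [Finite V] (hG : G.IsTree) {Δ : ℕ}
    (hΔ : ∀ x, (G.neighborSet x).ncard ≤ Δ) (x : Fin N × s.block) :
    ((s.pump N).neighborSet x).ncard ≤ Δ := by
  classical
  let g : Fin N × s.block → V := fun y =>
    if x.1 = y.1 then y.2 else if x.1.val + 1 = y.1.val then s.b else s.pa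
  have hg : ∀ y, (s.pump N).Adj x y → (x.1 = y.1 ∧ G.Adj x.2 y.2 ∧ g y = y.2) ∨
      (x.1.val + 1 = y.1.val ∧ y.2.val = s.a ∧ x.2.val = s.pb ∧ g y = s.b) ∨
      (y.1.val + 1 = x.1.val ∧ y.2.val = s.pb ∧ x.2.val = s.a ∧ g y = s.pa) := by
    rintro y (⟨h1, h2⟩ | ⟨h1, h2, h3⟩ | ⟨h1, h2, h3⟩)
    · exact Or.inl ⟨h1, h2, if_pos h1⟩
    · refine Or.inr (Or.inl ⟨h1, h3, h2, ?_⟩)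
      have : x.1 ≠ y.1 := fun h => by rw [h] at h1; omega
      simp only [g, if_neg this, if_pos h1]
    · refine Or.inr (Or.inr ⟨h1, h2, h3, ?_⟩)
      have h4 : x.1 ≠ y.1 := fun h => by rw [h] at h1; omega
      have h5 : x.1.val + 1 ≠ y.1.val := by omega
      simp only [g, if_neg h4, if_neg h5]
  have hab : s.b ≠ s.pa := fun h => s.pa_notMem hG (h ▸ s.b_mem hG)
  refine (Set.ncard_le_ncard_of_injOn g (fun y hy => ?_) (fun y hy y' hy' h => ?_)
    (Set.toFinite _)).trans (hΔ x.2)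
  · rcases hg y hy with ⟨_, h, e⟩ | ⟨_, _, h, e⟩ | ⟨_, _, h, e⟩
    · rw [e]; exact h
    · rw [e, mem_neighborSet, h]; exact s.isChild_b.1
    · rw [e, mem_neighborSet, h]; exact s.isChild_a.1.symm
  · rcases hg y hy with ⟨h1, h2, e⟩ | ⟨h1, h2, h3, e⟩ | ⟨h1, h2, h3, e⟩ <;>
    rcases hg y' hy' with ⟨h1', h2', e'⟩ | ⟨h1', h2', h3', e'⟩ | ⟨h1', h2', h3', e'⟩ <;>
    rw [e, e'] at h
    · exact Prod.ext (h1.symm.trans h1') (Subtype.ext h)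
    · exact absurd (h ▸ y.2.2) s.b_notMem_block
    · exact absurd (h ▸ y.2.2.1) (s.pa_notMem hG)
    · exact absurd (h ▸ y'.2.2) s.b_notMem_block
    · exact Prod.ext (Fin.ext (by omega)) (Subtype.ext (h2.trans h2'.symm))
    · exact absurd h hab
    · exact absurd (h ▸ y'.2.2.1) (s.pa_notMem hG)
    · exact absurd h.symm hab
    · exact Prod.ext (Fin.ext (by omega)) (Subtype.ext (h2.trans h2'.symm))

lemma copy_le_dist_pump [Finite V] (hG : G.IsTree) (x y : Fin N × s.block) :
    y.1.val ≤ x.1.val + (s.pump N).dist x y ∧ x.1.val ≤ y.1.val + (s.pump N).dist x y := by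
  have hN : 0 < N := by have := x.1.2; omega
  obtain ⟨p, hp⟩ := (s.pump_isTree hG hN).connected.exists_walk_length_eq_dist x y
  rw [← hp]
  clear hp
  induction p with
  | nil => simp
  | cons h q ih =>
    rw [Walk.length_cons]
    rcases h with ⟨h, _⟩ | ⟨h, _⟩ | ⟨h, _⟩
    · rw [h]; omega
    · omega
    · omega

open Classical in
/-- The vertex `z` of the `k`-th copy of the segment. -/
noncomputable def vertex (hG : G.IsTree) (N : ℕ) [NeZero N] (k : ℕ) (z : V) : Fin N × s.block :=
  (Fin.ofNat N k, if h : z ∈ s.block then ⟨z, h⟩ else ⟨s.a, s.a_mem_block hG⟩)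

open Classical in
/-- The `k`-th copy of the segment, continued into the neighboring copies. -/
noncomputable def unroll (hG : G.IsTree) (N : ℕ) [NeZero N] (k : ℕ) (z : V) : Fin N × s.block :=
  if z ∈ s.block then s.vertex hG N k z
  else if z ∈ G.desc v s.b then s.vertex hG N (k + 1) (s.φ' z)
  else s.vertex hG N (k - 1) (s.φ z)

variable [NeZero N] {k : ℕ} {y z : V}

lemma vertex_fst (hG : G.IsTree) (hk : k < N) : (s.vertex hG N k z).1.val = k := by
  simp [vertex, Fin.ofNat, Nat.mod_eq_of_lt hk]

lemma vertex_snd (hG : G.IsTree) (hz : z ∈ s.block) : (s.vertex hG N k z).2.val = z := by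
  simp [vertex, hz]

lemma vertex_eq (hG : G.IsTree) (x : Fin N × s.block) : s.vertex hG N x.1 x.2 = x :=
  Prod.ext (Fin.ext (s.vertex_fst hG x.1.2)) (Subtype.ext (s.vertex_snd hG x.2.2))

lemma unroll_of_mem_block (hG : G.IsTree) (hz : z ∈ s.block) :
    s.unroll hG N k z = s.vertex hG N k z := if_pos hz

lemma unroll_of_mem_desc (hG : G.IsTree) (hz : z ∈ G.desc v s.b) :
    s.unroll hG N k z = s.vertex hG N (k + 1) (s.φ' z) := by
  rw [unroll, if_neg fun h => h.2 hz, if_pos hz]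

lemma unroll_of_notMem_desc (hG : G.IsTree) (hz : z ∉ G.desc v s.a) :
    s.unroll hG N k z = s.vertex hG N (k - 1) (s.φ z) := by
  rw [unroll, if_neg fun h => hz h.1, if_neg fun h => hz (hG.desc_subset (s.b_mem hG) h)]

/-- The gluing identity: the surroundings of `b` seen from copy `k` are those of `a` seen from copy
`k + 1`. -/
lemma unroll_φ (hG : G.IsTree) (hz : G.dist s.a z ≤ r) :
    s.unroll hG N k (s.φ z) = s.unroll hG N (k + 1) z := by
  by_cases h : z ∈ G.desc v s.a
  · rw [s.unroll_of_mem_block hG (s.mem_block_of_dist_a hG h hz),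
      s.unroll_of_mem_desc hG ((s.φ_mem z hz).2 h), s.φ'_φ z hz]
  · rw [s.unroll_of_notMem_desc hG h, s.unroll_of_mem_block hG, Nat.add_sub_cancel]
    exact s.mem_block_of_dist_b hG ((s.φ_mem z hz).not.2 h) (by rwa [s.dist_φ z hz])

/-- Only `a` and `pb` have edges to other copies, so the bounds on `k` are asked for there alone.
This makes the lemma usable in the outermost copies. -/
lemma bijOn_unroll_of_mem_block (hG : G.IsTree) (hr : 0 < r) (hk : k < N) (hz : z ∈ s.block)
    (hza : z = s.a → 1 ≤ k) (hzb : z = s.pb → k + 1 < N) :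
    Set.BijOn (s.unroll hG N k) (G.neighborSet z) ((s.pump N).neighborSet (s.unroll hG N k z)) := by
  have hc : ∀ y, G.Adj z y → (y ∈ s.block ∧ s.unroll hG N k y = s.vertex hG N k y) ∨
      (z = s.pb ∧ y = s.b ∧ s.unroll hG N k y = s.vertex hG N (k + 1) s.a) ∨
      (z = s.a ∧ y = s.pa ∧ s.unroll hG N k y = s.vertex hG N (k - 1) s.pb) := by
    intro y hy
    by_cases h1 : y ∈ s.block
    · exact Or.inl ⟨h1, s.unroll_of_mem_block hG h1⟩
    by_cases h2 : y ∈ G.desc v s.b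
    · obtain ⟨rfl, h3⟩ := hG.desc_exit h2 hz.2 hy.symm
      refine Or.inr (Or.inl ⟨hG.isChild_unique h3 s.isChild_b, rfl, ?_⟩)
      rw [s.unroll_of_mem_desc hG h2, s.φ'_b hG]
    · have h3 : y ∉ G.desc v s.a := fun h => h1 ⟨h, h2⟩
      obtain ⟨rfl, h4⟩ := hG.desc_exit hz.1 h3 hy
      obtain rfl := hG.isChild_unique h4 s.isChild_a
      refine Or.inr (Or.inr ⟨rfl, rfl, ?_⟩)
      rw [s.unroll_of_notMem_desc hG h3, s.φ_pa hG hr]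
  have hA := s.a_mem_block hG
  have hB := s.pb_mem_block hG
  rw [s.unroll_of_mem_block hG hz]
  refine ⟨fun y hy => ?_, fun y hy y' hy' h => ?_, fun w hw => ?_⟩
  · rcases hc y hy with ⟨h1, e⟩ | ⟨h1, h2, e⟩ | ⟨h1, h2, e⟩ <;> rw [e]
    · exact Or.inl ⟨rfl, by rw [s.vertex_snd hG hz, s.vertex_snd hG h1]; exact hy⟩
    · exact Or.inr (Or.inl ⟨by rw [s.vertex_fst hG hk, s.vertex_fst hG (hzb h1)],
        by rw [s.vertex_snd hG hz, h1], s.vertex_snd hG hA⟩)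
    · have := hza h1
      exact Or.inr (Or.inr ⟨by rw [s.vertex_fst hG hk, s.vertex_fst hG (by omega)]; omega,
        s.vertex_snd hG hB, by rw [s.vertex_snd hG hz, h1]⟩)
  · have hcopy := congrArg (fun x => x.1.val) h
    have hvert := congrArg (fun x => x.2.val) h
    rcases hc y hy with ⟨h1, e⟩ | ⟨h1, h2, e⟩ | ⟨h1, h2, e⟩ <;>
    rcases hc y' hy' with ⟨h1', e'⟩ | ⟨h1', h2', e'⟩ | ⟨h1', h2', e'⟩ <;>
    rw [e, e'] at hcopy hvert
    · rwa [s.vertex_snd hG h1, s.vertex_snd hG h1'] at hvert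
    · rw [s.vertex_fst hG hk, s.vertex_fst hG (hzb h1')] at hcopy
      omega
    · have := hza h1'
      rw [s.vertex_fst hG hk, s.vertex_fst hG (by omega)] at hcopy
      omega
    · rw [s.vertex_fst hG hk, s.vertex_fst hG (hzb h1)] at hcopy
      omega
    · rw [h2, h2']
    · have := hza h1'
      rw [s.vertex_fst hG (hzb h1), s.vertex_fst hG (by omega)] at hcopy
      omega
    · have := hza h1
      rw [s.vertex_fst hG hk, s.vertex_fst hG (by omega)] at hcopy
      omega
    · have := hza h1
      rw [s.vertex_fst hG (hzb h1'), s.vertex_fst hG (by omega)] at hcopy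
      omega
    · rw [h2, h2']
  · rcases hw with ⟨h1, h2⟩ | ⟨h1, h2, h3⟩ | ⟨h1, h2, h3⟩
    · rw [s.vertex_snd hG hz] at h2
      refine ⟨w.2, h2, ?_⟩
      rw [s.unroll_of_mem_block hG w.2.2]
      exact Prod.ext h1 (Subtype.ext (s.vertex_snd hG w.2.2))
    · rw [s.vertex_snd hG hz] at h2
      rw [s.vertex_fst hG hk] at h1
      refine ⟨s.b, h2 ▸ s.isChild_b.1, ?_⟩
      rw [s.unroll_of_mem_desc hG (mem_desc_self _ _), s.φ'_b hG, h1, ← h3, vertex_eq]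
    · rw [s.vertex_snd hG hz] at h3
      rw [s.vertex_fst hG hk] at h1
      refine ⟨s.pa, h3 ▸ s.isChild_a.1.symm, ?_⟩
      rw [s.unroll_of_notMem_desc hG (s.pa_notMem hG), s.φ_pa hG hr, ← h1, Nat.add_sub_cancel,
        ← h2, vertex_eq]

lemma bijOn_unroll (hG : G.IsTree) (hk : 1 ≤ k) (hkN : k + 1 < N) (hy : y ∈ s.block)
    (hyz : G.dist y z < r) :
    Set.BijOn (s.unroll hG N k) (G.neighborSet z) ((s.pump N).neighborSet (s.unroll hG N k z)) := by
  have hr : 0 < r := by omega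
  have hadj : ∀ {x w}, G.dist x z < r → w ∈ G.neighborSet z → G.dist x w ≤ r := by
    intro x w hx hw
    have ht := hG.connected.dist_triangle (u := x) (v := z) (w := w)
    rw [dist_eq_one_iff_adj.2 hw] at ht
    omega
  by_cases h1 : z ∈ s.block
  · exact s.bijOn_unroll_of_mem_block hG hr (by omega) h1 (fun _ => hk) (fun _ => hkN)
  by_cases h2 : z ∈ G.desc v s.b
  · have hd := hG.dist_of_mem_desc h2 hy.2
    rw [dist_comm] at hyz
    obtain ⟨x, hx, rfl⟩ : ∃ x, G.dist s.a x < r ∧ s.φ x = z := by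
      have hb : G.dist s.b z < r := by rw [dist_comm]; omega
      exact ⟨s.φ' z, by rwa [s.dist_φ' z hb.le], s.φ_φ' z hb.le⟩
    have hxb := s.mem_block_of_dist_a hG ((s.φ_mem x hx.le).1 h2) hx.le
    -- Otherwise `b` would be within distance `r` of `a`.
    have hne : x ≠ s.pb := by
      rintro rfl
      have ht := hG.connected.dist_triangle (u := s.a) (v := s.pb) (w := s.b)
      rw [dist_eq_one_iff_adj.2 s.isChild_b.1] at ht
      have := s.lt_dist
      omega
    have hcore := s.bijOn_unroll_of_mem_block (N := N) (k := k + 1) hG hr (by omega) hxb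
      (fun _ => by omega) (fun h => absurd h hne)
    have hφ := s.bijOn_φ hG hx
    rw [s.unroll_φ hG hx.le, ← hφ.image_eq, ← Set.bijOn_comp_iff hφ.injOn]
    refine hcore.congr fun w hw => (s.unroll_φ hG ?_).symm
    have ht := hG.connected.dist_triangle (u := s.a) (v := x) (w := w)
    rw [dist_eq_one_iff_adj.2 hw] at ht
    omega
  · have h3 : z ∉ G.desc v s.a := fun h => h1 ⟨h, h2⟩
    have hd := hG.dist_of_mem_desc hy.1 h3
    have hx : G.dist s.a z < r := by omega
    obtain ⟨k, rfl⟩ : ∃ j, k = j + 1 := ⟨k - 1, by omega⟩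
    have hb : G.dist s.b (s.φ z) < r := by rwa [s.dist_φ z hx.le]
    have hxb := s.mem_block_of_dist_b hG ((s.φ_mem z hx.le).not.2 h3) hb.le
    have hne : s.φ z ≠ s.a := by
      intro h
      have := s.lt_dist
      rw [h, dist_comm] at hb
      omega
    have hcore := s.bijOn_unroll_of_mem_block (N := N) (k := k) hG hr (by omega) hxb
      (fun h => absurd h hne) (fun _ => by omega)
    rw [s.unroll_φ hG hx.le] at hcore
    refine (hcore.comp (s.bijOn_φ hG hx)).congr fun w hw => s.unroll_φ hG (hadj hx hw)

end Segment

end SimpleGraph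

/-! ### From a long critical path to a labeled segment, by pigeonhole. -/

namespace Mending

universe u v

open SimpleGraph

variable {S : Type u} {Γ : Type v} {ψ : Verifier S Γ} {r : ℕ} {𝒢 : Set (InputGraph S)}
  {G : InputGraph S} {old : G.V → Option Γ} {v : G.V} {t : ℕ}

namespace CriticalPath

variable {L : ℕ} {p : ℕ → G.V}

lemma dist_root (hp : CriticalPath ψ r G old v t L p) {a : ℕ} (ha : a ≤ L) :
    G.graph.dist v (p a) = G.graph.dist v (p 0) + a := by
  induction a with
  | zero => rfl
  | succ a ih => rw [(hp.isChild a ha).2, ih (by omega), add_assoc]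

lemma mem_desc (hp : CriticalPath ψ r G old v t L p) (hT : G.graph.IsTree) {a b : ℕ} (hab : a ≤ b)
    (hb : b ≤ L) : p b ∈ G.graph.desc v (p a) := by
  induction b, hab using Nat.le_induction with
  | base => exact mem_desc_self _ _
  | succ b hab ih => exact hT.desc_subset (ih (by omega)) (hp.isChild b hb).mem_desc

lemma dist_eq (hp : CriticalPath ψ r G old v t L p) (hT : G.graph.IsTree) {a b : ℕ} (hab : a ≤ b)
    (hb : b ≤ L) : G.graph.dist (p a) (p b) = b - a := by
  have h1 : G.graph.dist v (p b) = G.graph.dist v (p a) + G.graph.dist (p a) (p b) :=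
    hp.mem_desc hT hab hb
  have := hp.dist_root (a := a) (by omega)
  have := hp.dist_root hb
  omega

/-- Extensions can be pulled up along a critical path. -/
lemma extends_of_le (hp : CriticalPath ψ r G old v t L p) (hψ : ψ.IsLocal 𝒢 r) (hG : G ∈ 𝒢)
    (hT : G.graph.IsTree) {a b : ℕ} (hab : a ≤ b) (hb : b ≤ L) {ν : G.V → Option Γ}
    (hν : GoodOn ψ r G old (G.graph.desc v (p a) \ G.graph.desc v (p b)) ν)
    (hE : Extends ψ r G old v t (p b) ν) : Extends ψ r G old v t (p a) ν := by
  induction b, hab using Nat.le_induction with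
  | base => exact hE
  | succ b hab ih =>
    have hc := hp.isChild b hb
    have hm := hp.mem_desc hT hab (by omega)
    refine ih (by omega) (hν.mono ?_) ?_
    · exact Set.sdiff_subset_sdiff_right (hT.desc_subset hc.mem_desc)
    · obtain ⟨h1, h2⟩ := hν (p b) ⟨hm, hc.not_mem_desc hT⟩
      have := hp.depth
      refine extends_of_isChild hψ hG hT (by rw [hp.dist_root (by omega)]; omega) h1 h2
        fun w hw => ?_
      -- Children off the path are not critical, so a labeling that is good below them extends for
      -- free.
      by_cases hne : w = p (b + 1)
      · rw [hne]
        exact hE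
      · refine extends_of_not_critical (fun hwc => hne (hp.unique b hb w hw hwc))
          (hν.mono fun x hx => ⟨?_, fun hx' => ?_⟩)
        · exact hT.desc_subset hm (hT.desc_subset hw.mem_desc hx)
        · exact Set.disjoint_left.1 (hT.desc_disjoint (by rw [hw.2, hc.2]) hne) hx hx'

end CriticalPath

/-- The finite type of all descriptions of a vertex neighborhood that is enumerated by `Fin M`. -/
abbrev ViewCode (S : Type u) (Γ : Type v) (r M : ℕ) : Type (max u v) :=
  (Fin M → Fin M → Prop × Prop) ×
    (Fin M → S × Option Γ × Option Γ × Prop × Fin (r + 1)) × Set (Fin M → Option Γ)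

/-- The description of the neighborhood of `u` that is enumerated by `e`, with the labelings `old`
and `new`. -/
noncomputable def viewCode (ψ : Verifier S Γ) (r : ℕ) (G : InputGraph S) (old : G.V → Option Γ) (v : G.V)
    (t : ℕ) (new : G.V → Option Γ) {M : ℕ} (u : G.V) (e : Fin M → G.V) : ViewCode S Γ r M :=
  (fun x y => (e x = e y, G.graph.Adj (e x) (e y)),
    fun x => (G.input (e x), old (e x), new (e x), e x ∈ G.graph.desc v u,
      Fin.ofNat (r + 1) (G.graph.dist u (e x))),
    {τ | ∃ ν, Extends ψ r G old v t u ν ∧ ∀ x, τ x = ν (e x)})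

/-- Enumerating with repetitions gives balls of different sizes a common index type; `viewCode`
therefore records which indices coincide. -/
lemma exists_range_eq {V : Type*} {s : Set V} (hs : s.Finite) (hne : s.Nonempty) {M : ℕ}
    (hM : s.ncard ≤ M) : ∃ e : Fin M → V, Set.range e = s := by
  classical
  have := hs.fintype
  have := hne.to_subtype
  have hc : Fintype.card s ≤ Fintype.card (Fin M) := by
    rwa [Fintype.card_fin, ← Nat.card_eq_fintype_card, Nat.card_coe_set_eq]
  obtain ⟨g⟩ := Function.Embedding.nonempty_of_card_le hc
  refine ⟨fun x => (Function.invFun g x : s), ?_⟩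
  have := (Function.invFun_surjective g.injective).range_comp (Subtype.val : s → V)
  rw [Subtype.range_coe] at this
  exact this

/-- A segment whose end isomorphism preserves the input, the labelings `old` and `new`, and the
extendability of labelings. -/
structure LabeledSegment (ψ : Verifier S Γ) (r : ℕ) (G : InputGraph S) (old : G.V → Option Γ)
    (v : G.V) (t : ℕ) (new : G.V → Option Γ) extends G.graph.Segment v r where
  input_φ : ∀ z, G.graph.dist a z ≤ r → G.input (φ z) = G.input z
  old_φ : ∀ z, G.graph.dist a z ≤ r → old (φ z) = old z
  new_φ : ∀ z, G.graph.dist a z ≤ r → new (φ z) = new z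
  extends_φ : ∀ ν ν' : G.V → Option Γ, (∀ z, G.graph.dist a z ≤ r → ν' (φ z) = ν z) →
    Extends ψ r G old v t a ν → Extends ψ r G old v t b ν'
  good_new : GoodOn ψ r G old (G.graph.desc v a) new
  not_extends_new : ¬ Extends ψ r G old v t a new
  extends_of_good : ∀ ν : G.V → Option Γ,
    GoodOn ψ r G old (G.graph.desc v a \ G.graph.desc v b) ν →
    Extends ψ r G old v t b ν → Extends ψ r G old v t a ν

/-- Two vertices of a critical path with the same code bound a labeled segment. -/
lemma CriticalPath.exists_labeledSegment_of_viewCode_eq {L : ℕ} {p : ℕ → G.V}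
    (hp : CriticalPath ψ r G old v t L p) (hψ : ψ.IsLocal 𝒢 r) (hG : G ∈ 𝒢)
    (hT : G.graph.IsTree) {new : G.V → Option Γ}
    (hnew : GoodOn ψ r G old (G.graph.desc v (p 0)) new)
    (hE : ¬ Extends ψ r G old v t (p 0) new) {i j M : ℕ} (hij : i + 1 + r < j + 1)
    (hj : j + 1 ≤ L) {ei ej : Fin M → G.V}
    (hei : Set.range ei = {x | G.graph.dist (p (i + 1)) x ≤ r})
    (hej : Set.range ej = {x | G.graph.dist (p (j + 1)) x ≤ r})
    (hcode : viewCode ψ r G old v t new (p (i + 1)) ei =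
      viewCode ψ r G old v t new (p (j + 1)) ej) :
    Nonempty (LabeledSegment ψ r G old v t new) := by
  have hball : ∀ z, G.graph.dist (p (i + 1)) z ≤ r → ∃ x, ei x = z := fun z hz =>
    (Set.ext_iff.1 hei z).2 hz
  have hball' : ∀ z, G.graph.dist (p (j + 1)) z ≤ r → ∃ x, ej x = z := fun z hz =>
    (Set.ext_iff.1 hej z).2 hz
  have hdi : ∀ x, G.graph.dist (p (i + 1)) (ei x) ≤ r := fun x =>
    (Set.ext_iff.1 hei _).1 ⟨x, rfl⟩
  have hdj : ∀ x, G.graph.dist (p (j + 1)) (ej x) ≤ r := fun x =>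
    (Set.ext_iff.1 hej _).1 ⟨x, rfl⟩
  have : Nonempty (Fin M) := ⟨(hball (p (i + 1)) (by simp)).choose⟩
  have c1 := fun x y => congrFun (congrFun (congrArg Prod.fst hcode) x) y
  have c2 := fun x => congrFun (congrArg (fun c => c.2.1) hcode) x
  have c3 := congrArg (fun c => c.2.2) hcode
  simp only [viewCode, Prod.mk.injEq, eq_iff_iff] at c1 c2 c3
  have hdist : ∀ x, G.graph.dist (p (j + 1)) (ej x) = G.graph.dist (p (i + 1)) (ei x) := by
    intro x
    have := congrArg Fin.val (c2 x).2.2.2.2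
    simp only [Fin.ofNat] at this
    rw [Nat.mod_eq_of_lt (Nat.lt_succ_of_le (hdi x)),
      Nat.mod_eq_of_lt (Nat.lt_succ_of_le (hdj x))] at this
    exact this.symm
  let φ : G.V → G.V := fun z => ej (Function.invFun ei z)
  let φ' : G.V → G.V := fun z => ei (Function.invFun ej z)
  have hφ : ∀ x, φ (ei x) = ej x := fun x =>
    (c1 _ _).1.1 (Function.invFun_eq (f := ei) ⟨x, rfl⟩)
  have hφ' : ∀ x, φ' (ej x) = ei x := fun x =>
    (c1 _ _).1.2 (Function.invFun_eq (f := ej) ⟨x, rfl⟩)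
  have hmono : ∀ {a b}, a ≤ b → b ≤ L → G.graph.desc v (p b) ⊆ G.graph.desc v (p a) :=
    fun hab hb => hT.desc_subset (hp.mem_desc hT hab hb)
  refine ⟨{
    a := p (i + 1), b := p (j + 1), pa := p i, pb := p j, φ := φ, φ' := φ'
    isChild_a := hp.isChild i (by omega)
    isChild_b := hp.isChild j (by omega)
    pb_mem := hp.mem_desc hT (by omega) (by omega)
    lt_dist := by rw [hp.dist_eq hT (by omega) (by omega)]; omega
    dist_φ := ?_, dist_φ' := ?_, φ'_φ := ?_, φ_φ' := ?_, φ_mem := ?_, adj_φ := ?_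
    input_φ := ?_, old_φ := ?_, new_φ := ?_, extends_φ := ?_
    good_new := hnew.mono (hmono (by omega) (by omega))
    not_extends_new := fun h => hE (hp.extends_of_le hψ hG hT (by omega) (by omega)
      (hnew.mono Set.sdiff_subset) h)
    extends_of_good := fun ν hν h => hp.extends_of_le hψ hG hT (by omega) (by omega) hν h }⟩
  · intro z hz
    obtain ⟨x, rfl⟩ := hball z hz
    rw [hφ, hdist]
  · intro z hz
    obtain ⟨x, rfl⟩ := hball' z hz
    rw [hφ', hdist]
  · intro z hz
    obtain ⟨x, rfl⟩ := hball z hz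
    rw [hφ, hφ']
  · intro z hz
    obtain ⟨x, rfl⟩ := hball' z hz
    rw [hφ', hφ]
  · intro z hz
    obtain ⟨x, rfl⟩ := hball z hz
    rw [hφ]
    exact (c2 x).2.2.2.1.symm
  · intro z z' hz hz'
    obtain ⟨x, rfl⟩ := hball z hz
    obtain ⟨y, rfl⟩ := hball z' hz'
    rw [hφ, hφ]
    exact (c1 x y).2.symm
  · intro z hz
    obtain ⟨x, rfl⟩ := hball z hz
    rw [hφ]
    exact (c2 x).1.symm
  · intro z hz
    obtain ⟨x, rfl⟩ := hball z hz
    rw [hφ]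
    exact (c2 x).2.1.symm
  · intro z hz
    obtain ⟨x, rfl⟩ := hball z hz
    rw [hφ]
    exact (c2 x).2.2.1.symm
  · intro ν ν' hν hνE
    obtain ⟨ν'', h1, h2⟩ := (Set.ext_iff.1 c3 fun x => ν (ei x)).1 ⟨ν, hνE, fun _ => rfl⟩
    refine h1.congr fun z hz => ?_
    obtain ⟨x, rfl⟩ := hball' z ((InputGraph.mem_ball hT.connected).1 hz)
    rw [← h2 x, ← hφ, hν _ (hdi x)]

/-- A sufficiently long critical path contains a labeled segment. -/
lemma CriticalPath.exists_labeledSegment [Finite S] [Finite Γ] {Δ : ℕ} {p : ℕ → G.V}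
    (hp : CriticalPath ψ r G old v t
      (Nat.card (ViewCode S Γ r ((Δ + 1) ^ r)) * (r + 1) + 1) p)
    (hψ : ψ.IsLocal 𝒢 r) (hG : G ∈ 𝒢) (hT : G.graph.IsTree)
    (hΔ : ∀ x, (G.graph.neighborSet x).ncard ≤ Δ) :
    ∃ new, Nonempty (LabeledSegment ψ r G old v t new) := by
  obtain ⟨new, hnew, hE⟩ := hp.start
  have hex : ∀ u : G.V, ∃ e : Fin ((Δ + 1) ^ r) → G.V,
      Set.range e = {x | G.graph.dist u x ≤ r} := fun u =>
    exists_range_eq (Set.toFinite _) ⟨u, by simp⟩ (hT.connected.ncard_dist_le hΔ u r)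
  choose e he using hex
  set C := Nat.card (ViewCode S Γ r ((Δ + 1) ^ r))
  -- Sampling every `r + 1` steps puts the samples more than `r` apart; the offset `1` leaves each
  -- of them a parent on the path.
  let c : Fin (C + 1) → ViewCode S Γ r ((Δ + 1) ^ r) := fun m =>
    viewCode ψ r G old v t new (p (m * (r + 1) + 1)) (e (p (m * (r + 1) + 1)))
  have hninj : ¬ Function.Injective c := by
    intro h
    have := Nat.card_le_card_of_injective c h
    rw [Nat.card_fin] at this
    omega
  have hlt : ∃ m m' : Fin (C + 1), m < m' ∧ c m = c m' := by
    rw [Function.not_injective_iff] at hninj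
    obtain ⟨m, m', h, hne⟩ := hninj
    rcases lt_or_gt_of_ne hne with h' | h'
    · exact ⟨m, m', h', h⟩
    · exact ⟨m', m, h', h.symm⟩
  obtain ⟨m, m', hlt, hc⟩ := hlt
  have h1 : (m.val + 1) * (r + 1) ≤ m'.val * (r + 1) := Nat.mul_le_mul_right _ hlt
  have h2 : m'.val * (r + 1) ≤ C * (r + 1) := Nat.mul_le_mul_right _ (by omega)
  rw [Nat.succ_mul] at h1
  exact ⟨new, hp.exists_labeledSegment_of_viewCode_eq hψ hG hT hnew hE (by omega) (by omega)
    (he _) (he _) hc⟩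

end Mending

/-! ### Where views land in the pumped tree. -/

namespace SimpleGraph.Segment

variable {V : Type*} {G : SimpleGraph V} {v : V} {r N k : ℕ} [NeZero N] (s : G.Segment v r)

/-- The bounds on `dist y s.b` and `dist y s.a` record that a view leaves its copy only through a
junction it contains; a view that avoids the hole thus stays on one side of it. -/
lemma exists_unroll_eq_vertex (hG : G.IsTree) {y z : V} (hy : y ∈ s.block)
    (hyz : G.dist y z ≤ r) :
    ∃ k' z', z' ∈ s.block ∧ s.unroll hG N k z = s.vertex hG N k' z' ∧
      ((k' = k ∧ z' = z) ∨
        (k' = k + 1 ∧ z = s.φ z' ∧ G.dist s.a z' ≤ r ∧ G.dist y s.b ≤ r) ∨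
        (k' = k - 1 ∧ z' = s.φ z ∧ G.dist s.a z ≤ r ∧ G.dist y s.a ≤ r)) := by
  by_cases h1 : z ∈ s.block
  · exact ⟨k, z, h1, s.unroll_of_mem_block hG h1, Or.inl ⟨rfl, rfl⟩⟩
  by_cases h2 : z ∈ G.desc v s.b
  · have hd := hG.dist_of_mem_desc h2 hy.2
    rw [dist_comm, dist_comm (v := s.b), dist_comm (v := y)] at hd
    have hz : G.dist s.b z ≤ r := by omega
    have hz' : G.dist s.a (s.φ' z) ≤ r := by rwa [s.dist_φ' z hz]
    refine ⟨k + 1, s.φ' z, s.mem_block_of_dist_a hG ?_ hz', s.unroll_of_mem_desc hG h2,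
      Or.inr (Or.inl ⟨rfl, (s.φ_φ' z hz).symm, hz', by omega⟩)⟩
    rwa [← s.φ_mem _ hz', s.φ_φ' z hz]
  · have h3 : z ∉ G.desc v s.a := fun h => h1 ⟨h, h2⟩
    have hd := hG.dist_of_mem_desc hy.1 h3
    have hz : G.dist s.a z ≤ r := by omega
    exact ⟨k - 1, s.φ z, s.mem_block_of_dist_b hG ((s.φ_mem z hz).not.2 h3)
      (by rwa [s.dist_φ z hz]), s.unroll_of_notMem_desc hG h3,
      Or.inr (Or.inr ⟨rfl, rfl, hz, by omega⟩)⟩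

end SimpleGraph.Segment

/-! ### Labeling the pumped tree, and the contradiction. -/

namespace Mending

universe u v

open SimpleGraph

variable {S : Type u} {Γ : Type v} {ψ : Verifier S Γ} {r : ℕ} {Δ : ℕ}
  {G : InputGraph S} {old new : G.V → Option Γ} {v : G.V} {t : ℕ}

namespace LabeledSegment

variable (s : LabeledSegment ψ r G old v t new)

/-- The tree that consists of `N` copies of the segment, with its input labeling. -/
abbrev pumped (N : ℕ) : InputGraph S where
  V := Fin N × s.block
  finite_V := inferInstance
  graph := s.pump N
  input x := G.input x.2

variable {N : ℕ}

lemma pumped_mem (hG : G ∈ boundedDegreeTrees S Δ) (hT : G.graph.IsTree) (hN : 0 < N) :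
    s.pumped N ∈ boundedDegreeTrees S Δ :=
  ⟨s.pump_isTree hT hN, s.ncard_neighborSet_pump hT hG.2⟩

lemma pumped_sameView [NeZero N] (hT : G.graph.IsTree) {k : ℕ} (hk : 1 ≤ k)
    (hkN : k + 1 < N) {y : G.V} (hy : y ∈ s.block) {X : Type*} {out : G.V → X}
    {out' : (s.pumped N).V → X}
    (hout : ∀ z, G.graph.dist y z ≤ r → out' (s.unroll hT N k z) = out z) :
    SameView r G out y (s.pumped N) out' (s.vertex hT N k y) := by
  rw [← s.unroll_of_mem_block hT hy]
  refine SameView.of_bijOn_neighborSet (H := s.pumped N) hT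
    (s.pump_isTree hT (by omega)) (fun z hz => s.bijOn_unroll hT hk hkN hy hz)
    (fun z hz => ?_) hout
  obtain ⟨k', z', hz', e, h⟩ := s.exists_unroll_eq_vertex (N := N) (k := k) hT hy hz
  rw [e]
  change G.input (s.vertex hT N k' z').2 = _
  rw [s.vertex_snd hT hz']
  rcases h with ⟨-, rfl⟩ | ⟨-, rfl, h, -⟩ | ⟨-, rfl, h, -⟩
  · rfl
  · exact (s.input_φ _ h).symm
  · exact s.input_φ _ h

open Classical in
/-- The labeling of the pumped tree: `new` above the hole in the `K`-th copy, and `old` below it;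
the outermost copies are empty. -/
noncomputable def pumpedLabel (N K : ℕ) (x : Fin N × s.block) : Option Γ :=
  -- Empty outermost copies satisfy the relaxed verifier near the two ends, where the pumped tree
  -- need not look like `G`.
  if x.1.val = 0 ∨ x.1.val + 1 = N ∨ (x.1.val = K ∧ x.2.val = s.a) then none
  else if x.1.val < K then new x.2 else old x.2

variable {K : ℕ}

lemma pumpedLabel_vertex [NeZero N] (hT : G.graph.IsTree) {k : ℕ} (hk : 1 ≤ k)
    (hkN : k + 1 < N) {y : G.V} (hy : y ∈ s.block) (h : ¬ (k = K ∧ y = s.a)) :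
    s.pumpedLabel N K (s.vertex hT N k y) = if k < K then new y else old y := by
  rw [pumpedLabel, s.vertex_fst hT (by omega), s.vertex_snd hT hy, if_neg]
  rintro (h1 | h1 | h1)
  · omega
  · omega
  · exact h h1

/-- The hole sits at the only junction between the `new` copies and the `old` copies. A view without
empty labels lies on one side of it and is therefore a view of `G` labeled by `new` or by `old`. -/
lemma pumpedLabel_accepts (hψ : ψ.IsLocal (boundedDegreeTrees S Δ) r)
    (hG : G ∈ boundedDegreeTrees S Δ) (hT : G.graph.IsTree) (hold : (ψ.star r).Accepts G old) (hN : 0 < N) :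
    (ψ.star r).Accepts (s.pumped N) (s.pumpedLabel N K) := by
  intro x
  by_cases hhole : ∃ w ∈ (s.pumped N).ball x r, s.pumpedLabel N K w = none
  · exact Or.inl hhole
  have : NeZero N := ⟨hN.ne'⟩
  have hself : s.pumpedLabel N K x ≠ none := fun h => hhole ⟨x, InputGraph.self_mem_ball x, h⟩
  obtain ⟨k, hkN', y, hy, rfl⟩ : ∃ k < N, ∃ y ∈ s.block, x = s.vertex hT N k y :=
    ⟨x.1, x.1.2, x.2, x.2.2, (s.vertex_eq hT x).symm⟩
  have hk : 1 ≤ k := by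
    by_contra h
    refine hself (if_pos (Or.inl ?_))
    rw [s.vertex_fst hT hkN']
    omega
  have hkN : k + 1 < N := by
    by_contra h
    refine hself (if_pos (Or.inr (Or.inl ?_)))
    rw [s.vertex_fst hT hkN']
    omega
  have hne : ∀ z, G.graph.dist y z ≤ r → s.pumpedLabel N K (s.unroll hT N k z) ≠ none := by
    intro z hz h
    refine hhole ⟨_, ?_, h⟩
    have hH := s.pump_isTree hT hN
    rw [InputGraph.mem_ball hH.connected, ← s.unroll_of_mem_block hT hy]
    exact (hT.dist_map_eq hH (fun z hz => s.bijOn_unroll hT hk hkN hy hz) hz).trans_le hz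
  have hKa : s.pumpedLabel N K (s.vertex hT N K s.a) = none ∨ N ≤ K := by
    by_cases hKN : K < N
    · refine Or.inl (if_pos (Or.inr (Or.inr ?_)))
      rw [s.vertex_fst hT hKN, s.vertex_snd hT (s.a_mem_block hT)]
      exact ⟨rfl, rfl⟩
    · exact Or.inr (by omega)
  have ha : k = K → r < G.graph.dist y s.a := by
    rintro rfl
    by_contra! h
    refine hne _ h ?_
    rw [s.unroll_of_mem_block hT (s.a_mem_block hT)]
    exact hKa.resolve_right (by omega)
  have hb : k + 1 = K → r < G.graph.dist y s.b := by
    rintro rfl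
    by_contra! h
    refine hne _ h ?_
    rw [s.unroll_of_mem_desc hT (mem_desc_self _ _), s.φ'_b hT]
    exact hKa.resolve_right (by omega)
  have hview : SameView r G (if k < K then new else old) y (s.pumped N) (s.pumpedLabel N K)
      (s.vertex hT N k y) := by
    refine s.pumped_sameView hT hk hkN hy fun z hz => ?_
    have hz0 := hne z hz
    obtain ⟨k', z', hz', e, h⟩ := s.exists_unroll_eq_vertex (N := N) (k := k) hT hy hz
    rw [e] at hz0 ⊢
    have hk'N : k' < N := by omega
    have h1 : 1 ≤ k' := by
      by_contra hcon
      refine hz0 (if_pos (Or.inl ?_))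
      rw [s.vertex_fst hT hk'N]
      omega
    have h2 : k' + 1 < N := by
      by_contra hcon
      refine hz0 (if_pos (Or.inr (Or.inl ?_)))
      rw [s.vertex_fst hT hk'N]
      omega
    have h3 : ¬ (k' = K ∧ z' = s.a) := by
      intro hcon
      refine hz0 (if_pos (Or.inr (Or.inr ?_)))
      rwa [s.vertex_fst hT hk'N, s.vertex_snd hT hz']
    rw [s.pumpedLabel_vertex hT h1 h2 hz' h3]
    have h4 : k' < K ↔ k < K := by
      constructor
      · intro h5
        by_contra h6
        have := ha
        omega
      · intro h5
        by_contra h6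
        have := hb
        omega
    rw [ite_congr (propext h4) (fun _ => rfl) (fun _ => rfl)]
    rcases h with ⟨-, rfl⟩ | ⟨-, rfl, h, -⟩ | ⟨-, rfl, h, -⟩
    · split_ifs <;> rfl
    · split_ifs
      · exact (s.new_φ _ h).symm
      · exact (s.old_φ _ h).symm
    · split_ifs
      · exact s.new_φ _ h
      · exact s.old_φ _ h
  refine (hψ.star G hG _ (s.pumped_mem hG hT hN) _ _ _ _ hview).1 ?_
  split_ifs
  · exact (s.good_new y hy.1).1
  · exact hold y

/-- A labeled segment contradicts mends that are short compared with the pumped tree. -/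
lemma false_of_isMend (hψ : ψ.IsLocal (boundedDegreeTrees S Δ) r)
    (hG : G ∈ boundedDegreeTrees S Δ) (hT : G.graph.IsTree) (hold : (ψ.star r).Accepts G old) {T : ℕ} (hK : 7 ≤ K)
    (hTK : 2 * T ≤ K) {x : (s.pumped (2 * K)).V} (hx1 : x.1.val = K) (hx2 : x.2.val = s.a)
    {μ : (s.pumped (2 * K)).V → Option Γ}
    (hμ : ψ.IsMend r (s.pumped (2 * K)) T x (s.pumpedLabel (2 * K) K) μ) : False := by
  have hN : 0 < 2 * K := by omega
  have : NeZero (2 * K) := ⟨hN.ne'⟩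
  have hH := s.pump_isTree hT hN
  have hfar : ∀ w : (s.pumped (2 * K)).V, (w.1.val + T < K ∨ K + T < w.1.val) →
      μ w = s.pumpedLabel (2 * K) K w := by
    intro w hw
    by_contra hne
    have h1 := (InputGraph.mem_ball hH.connected).1 (hμ.near w hne)
    have h2 := s.copy_le_dist_pump hT x w
    change (s.pump (2 * K)).dist x w ≤ T at h1
    omega
  let ν : ℕ → G.V → Option Γ := fun k z => μ (s.unroll hT (2 * K) k z)
  have hgood : ∀ k, 1 ≤ k → k + 1 < 2 * K → GoodOn ψ r G old s.block (ν k) := by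
    intro k hk hkN y hy
    refine ⟨(hψ.star G hG _ (s.pumped_mem hG hT hN) _ _ _ _
      (s.pumped_sameView hT hk hkN hy fun z _ => rfl)).2 (hμ.accepts _), fun h => ?_⟩
    change μ (s.unroll hT (2 * K) k y) = none at h
    rw [s.unroll_of_mem_block hT hy] at h
    have h1 := hμ.no_new_hole _ h
    have h2 : ¬ (k = K ∧ y = s.a) := by
      rintro ⟨rfl, rfl⟩
      refine hμ.filled ?_
      rw [← s.vertex_eq hT x, hx1, hx2, h]
    rw [s.pumpedLabel_vertex hT hk hkN hy h2] at h1
    split_ifs at h1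
    · exact (s.good_new y hy.1).2 h1
    · exact h1
  -- The ball around `a` also meets copy `k - 1`, whence `2 ≤ k` and the extra `1` in the last
  -- bound.
  have hlabel : ∀ k, 2 ≤ k → k + 1 < 2 * K → (k + T < K ∨ K + T + 1 < k) →
      ∀ z ∈ G.ball s.a r, ν k z = if k < K then new z else old z := by
    intro k hk hkN hkT z hz
    rw [InputGraph.mem_ball hT.connected] at hz
    obtain ⟨k', z', hz', e, h⟩ := s.exists_unroll_eq_vertex (N := 2 * K) (k := k) hT
      (s.a_mem_block hT) hz
    have hlt := s.lt_dist
    have hk' : k' = k ∨ k' = k - 1 := by omega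
    change μ (s.unroll hT (2 * K) k z) = _
    rw [e, hfar _ (by rw [s.vertex_fst hT (by omega)]; omega),
      s.pumpedLabel_vertex hT (by omega) (by omega) hz' (by omega),
      ite_congr (propext (show k' < K ↔ k < K by omega)) (fun _ => rfl) (fun _ => rfl)]
    rcases h with ⟨-, rfl⟩ | ⟨-, rfl, h, -⟩ | ⟨-, rfl, h, -⟩
    · rfl
    · rw [s.new_φ _ h, s.old_φ _ h]
    · rw [s.new_φ _ h, s.old_φ _ h]
  -- Extendability climbs from copy `2 * K - 2` to copy `2`. From `7 ≤ K` and `2 * T ≤ K` follows `T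
  -- + 3 < K`, so the mend changes nothing near `a` in either of them.
  have hext : ∀ n, n + 4 ≤ 2 * K → Extends ψ r G old v t s.a (ν (2 * K - 2 - n)) := by
    intro n
    induction n with
    | zero =>
      intro _
      refine (extends_old hold s.a).congr fun z hz => ?_
      rw [hlabel _ (by omega) (by omega) (by omega) z hz, if_neg (by omega)]
    | succ n ih =>
      intro hn
      obtain ⟨k, hk⟩ : ∃ k, k = 2 * K - 2 - (n + 1) := ⟨_, rfl⟩
      have ih' := ih (by omega)
      rw [show 2 * K - 2 - n = k + 1 by omega] at ih'
      rw [← hk]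
      exact s.extends_of_good _ (hgood k (by omega) (by omega))
        (s.extends_φ _ _ (fun z hz => congrArg μ (s.unroll_φ hT hz)) ih')
  have h2 := hext (2 * K - 4) (by omega)
  rw [show 2 * K - 2 - (2 * K - 4) = 2 by omega] at h2
  refine s.not_extends_new (h2.congr fun z hz => ?_)
  rw [hlabel 2 le_rfl (by omega) (by omega) z hz, if_pos (by omega)]

lemma false_of_isMendable (s : LabeledSegment ψ r G old v t new)
    (hψ : ψ.IsLocal (boundedDegreeTrees S Δ) r)
    (hG : G ∈ boundedDegreeTrees S Δ) (hT' : G.graph.IsTree) (hold : (ψ.star r).Accepts G old) {T : ℕ → ℕ}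
    (hT : (fun n : ℕ => (T n : ℝ)) =o[atTop] (fun n : ℕ => (n : ℝ)))
    (hmend : ψ.IsMendable r (boundedDegreeTrees S Δ) T) : False := by
  have hb : 0 < Nat.card s.block := Nat.card_pos_iff.2
    ⟨⟨⟨s.a, s.a_mem_block hT'⟩⟩, inferInstance⟩
  have hb' : (0 : ℝ) < Nat.card s.block := by exact_mod_cast hb
  -- The pumped tree has `n = 2 * K * Nat.card s.block` nodes, so this constant yields `T n ≤ K /
  -- 2`.
  obtain ⟨n₀, hn₀⟩ := eventually_atTop.1 (hT.bound (c := 1 / (4 * Nat.card s.block)) (by positivity))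
  let K := n₀ + 7
  have hN : 0 < 2 * K := by omega
  have hcard : Nat.card (s.pumped (2 * K)).V = 2 * K * Nat.card s.block := by
    change Nat.card (Fin (2 * K) × s.block) = _
    rw [Nat.card_prod, Nat.card_fin]
  obtain ⟨μ, hμ⟩ := hmend _ (s.pumped_mem hG hT' hN) _ (s.pumpedLabel_accepts (K := K) hψ hG hT' hold hN)
    (⟨K, by omega⟩, ⟨s.a, s.a_mem_block hT'⟩)
  rw [hcard] at hμ
  refine s.false_of_isMend hψ hG hT' hold (K := K) (by omega) ?_ rfl rfl hμ
  have h1 := hn₀ (2 * K * Nat.card s.block) (by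
    have : 2 * K * 1 ≤ 2 * K * Nat.card s.block := Nat.mul_le_mul_left _ hb
    omega)
  rw [Real.norm_natCast, Real.norm_natCast, div_mul_eq_mul_div, one_mul, le_div_iff₀ (by positivity)]
    at h1
  push_cast at h1
  have h2 : (2 * T (2 * K * Nat.card s.block) : ℝ) ≤ K := by
    refine le_of_mul_le_mul_right ?_ hb'
    linarith
  exact_mod_cast h2

end LabeledSegment

/-! ### The gap between logarithmic and linear mending. -/

/-- Sublinear mends can be replaced by logarithmic ones. -/
lemma Verifier.IsMendable.exists_log [Finite S] [Finite Γ]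
    (hψ : ψ.IsLocal (boundedDegreeTrees S Δ) r) {T : ℕ → ℕ}
    (hT : (fun n : ℕ => (T n : ℝ)) =o[atTop] (fun n : ℕ => (n : ℝ)))
    (hmend : ψ.IsMendable r (boundedDegreeTrees S Δ) T) :
    ∃ T' : ℕ → ℕ,
      (fun n : ℕ => (T' n : ℝ)) =O[atTop] (fun n : ℕ => Real.log (n : ℝ)) ∧
      ψ.IsMendable r (boundedDegreeTrees S Δ) T' := by
  set L := Nat.card (ViewCode S Γ r ((Δ + 1) ^ r)) * (r + 1) + 1 with hL
  refine ⟨fun n => (Nat.log 2 n + 1) * L, ?_, fun G hG old hold v => ?_⟩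
  · refine IsBigO.of_bound (2 * L / Real.log 2) ?_
    filter_upwards [eventually_ge_atTop 2] with n hn
    have hlog2 : 0 < Real.log 2 := Real.log_pos one_lt_two
    have hn0 : (0 : ℝ) < n := by positivity
    have h1 : (Nat.log 2 n : ℝ) * Real.log 2 ≤ Real.log n := by
      rw [← Real.log_pow]
      exact Real.log_le_log (by positivity) (by exact_mod_cast Nat.pow_log_le_self 2 (by omega))
    have h2 : Real.log 2 ≤ Real.log n := Real.log_le_log two_pos (by exact_mod_cast hn)
    rw [Real.norm_natCast, Real.norm_of_nonneg (by linarith), div_mul_eq_mul_div,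
      le_div_iff₀ hlog2]
    push_cast
    have hL0 : (0 : ℝ) ≤ L := by positivity
    calc ((Nat.log 2 n : ℝ) + 1) * L * Real.log 2
        = L * (Nat.log 2 n * Real.log 2 + Real.log 2) := by ring
      _ ≤ L * (Real.log n + Real.log n) := by gcongr
      _ = 2 * L * Real.log n := by ring
  · obtain ⟨new, hnew⟩ := hmend G hG old hold v
    refine exists_isMend_of_not_criticalPath hψ hG hG.1 hnew fun t p hp => ?_
    obtain ⟨new, ⟨s⟩⟩ := hp.exists_labeledSegment hψ hG hG.1 hG.2
    exact s.false_of_isMendable hψ hG hG.1 hold hT hmend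

lemma Verifier.IsMendable.min {𝒢 : Set (InputGraph S)} {T T' : ℕ → ℕ}
    (h : ψ.IsMendable r 𝒢 T) (h' : ψ.IsMendable r 𝒢 T') :
    ψ.IsMendable r 𝒢 (fun n => min (T n) (T' n)) := by
  intro G hG old hold x
  rcases le_total (T (Nat.card G.V)) (T' (Nat.card G.V)) with hle | hle
  · simpa only [min_eq_left hle] using h G hG old hold x
  · simpa only [min_eq_right hle] using h' G hG old hold x

end Mending

theorem mainTheorem2 {S : Type*} {Γ : Type*} (Δ : ℕ) (P : Mending.Problem S Γ)
    (hP : P.IsLCL (Mending.boundedDegreeTrees S Δ)) :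
    (∀ T : ℕ → ℕ,
      (fun n : ℕ => (T n : ℝ)) =o[atTop] (fun n : ℕ => (n : ℝ)) →
      P.IsMendable (Mending.boundedDegreeTrees S Δ) T →
      ∃ T' : ℕ → ℕ,
        (fun n : ℕ => (T' n : ℝ)) =O[atTop] (fun n : ℕ => Real.log (n : ℝ)) ∧
        P.IsMendable (Mending.boundedDegreeTrees S Δ) T') ∧
    ¬ ∃ T : ℕ → ℕ,
      P.HasMendingRadius (Mending.boundedDegreeTrees S Δ) T ∧
      (fun n : ℕ => Real.log (n : ℝ)) =o[atTop] (fun n : ℕ => (T n : ℝ)) ∧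
      (fun n : ℕ => (T n : ℝ)) =o[atTop] (fun n : ℕ => (n : ℝ)) := by
  have := hP.finite_input
  have := hP.finite_output
  constructor
  · rintro T hT ⟨r, ψ, hψ, hmend⟩
    obtain ⟨T', hT', hmend'⟩ := hmend.exists_log hψ.1 hT
    exact ⟨T', hT', r, ψ, hψ, hmend'⟩
  · rintro ⟨T, ⟨⟨r, ψ, hψ, hmend⟩, hmin⟩, hlog, hT⟩
    obtain ⟨T', hT', hmend'⟩ := hmend.exists_log hψ.1 hT
    -- Both bounds hold for the same verifier, so their minimum does too. Minimality of `T` would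
    -- force `T ≤ T'`, although `T' = O(log n) = o(T)`.
    refine hmin (fun n => min (T n) (T' n)) (fun heq => ?_) (fun n => min_le_left _ _)
      ⟨r, ψ, hψ, hmend.min hmend'⟩
    have hlarge := ((hT'.trans_isLittleO hlog).bound (c := 1 / 2) (by norm_num)).and
      ((hlog.bound one_pos).and (eventually_ge_atTop 2))
    obtain ⟨n, h1, h2, hn⟩ := hlarge.exists
    have h3 : T n ≤ T' n := by
      have := congrFun heq n
      simp only [min_eq_left_iff] at this
      exact this
    have h4 : 0 < Real.log n := Real.log_pos (by exact_mod_cast hn)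
    rw [Real.norm_natCast, Real.norm_natCast] at h1
    rw [Real.norm_of_nonneg h4.le, Real.norm_natCast] at h2
    have h5 : (T n : ℝ) ≤ T' n := by exact_mod_cast h3
    linarith
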